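/- **Setting.** All trees are finite combinatorial trees. The *leaves* of a tree are its vertices of valence $1$; all other vertices are *internal*. $IV^X, IV^Y, IV^Z$ denote the sets of internal vertices of the trees $T^X, T^Y, T^Z$ below. A *topological tree of spheres* $\mathcal T^X$ marked by a finite set $X$ with at least three elements consists of a tree $T^X$ whose set of leaves is $X$ and in which every internal vertex has valence at least $3$, and, for each internal vertex $v$, of a topological $2$-sphere $\mathcal S_v$ and an injection $i_v$ from the set of edges at $v$ into $\mathcal S_v$; the points $i_v(e)$ are the *attaching points* on $\mathcal S_v$. For a leaf $x$, let $a_v(x)=i_v(e)$, where $e$ is the edge at $v$ in the direction of $x$. A *cover* $\mathcal F:\mathcal T^Y\to\mathcal T^Z$ consists of a map $F:T^Y\to T^Z$ on vertices and edges, sending an edge $\{v,v'\}$ to an edge $\{F(v),F(v')\}$, leaves to leaves and internal vertices to internal vertices, and, for each internal vertex $v$ of $T^Y$, of a topological branched covering $f_v:\mathcal S_v\to\mathcal S_{F(v)}$ such that: (a) $f_v$ restricts to a covering map from the complement of the attaching points in $\mathcal S_v$ to the complement of the attaching points in $\mathcal S_{F(v)}$; (b) $f_v(i_v(e))=i_{F(v)}(F(e))$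 for every edge $e$ at $v$; (c) for every edge $e$ joining two internal vertices $v,v'$, the local degree of $f_v$ at $i_v(e)$ equals that of $f_{v'}$ at $i_{v'}(e)$. Let $\deg(v)$ be the degree of $f_v$ for $v$ internal; for a leaf $y$ attached by an edge $e$ to the vertex $v$, let $\deg(y)$ be the local degree of $f_v$ at $i_v(e)$. The sum $\sum_{F(v)=w}\deg(v)$ is the same for all vertices $w$ of $T^Z$; it is the *degree* $\deg(\mathcal F)$. A vertex *separates* three vertices if these lie in three different components of the tree minus that vertex. Write $\mathcal T^X\triangleleft\mathcal T^Y$ if $X\subseteq Y$, $IV^X\subseteq IV^Y$, a vertex of $T^X$ separates three vertices of $T^X$ in $T^X$ if and only if it does so in $T^Y$, and for every internal vertex $v$ of $T^X$ the sphere $\mathcal S_v$ is the same in both trees and $a_v^X=a_v^Y|_X$. A *dynamical system of topological trees of spheres* $(\mathcal F,\mathcal T^X)$ is a cover $\mathcal F:\mathcal T^Y\to\mathcal T^Z$ together with a tree of spheres $\mathcal T^X$ such that $\mathcal T^X\triangleleft\mathcal T^Y$ and $\mathcal T^X\triangleleft\mathcal T^Z$. Let $\Sigma$ be the disjoint union of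 the spheres $\mathcal S_v$, $v\in IV^Y$. For $z\in\mathcal S_v\subseteq\Sigma$, the iterate $f^k(z)=f_{F^{k-1}(v)}\circ\dots\circ f_v(z)$ is defined when $v,F(v),\dots,F^{k-1}(v)$ are all internal vertices of $T^X$ (with $f^0(z)=z$), and the *orbit* of $z$ is the set of all its defined iterates. Two points of $\Sigma$ are in the same *grand orbit* if their orbits intersect. A point of $\mathcal S_v$, $v\in IV^Y$, is *critical* if the local degree of $f_v$ there is greater than $1$. A *cycle of spheres* is a cycle $v,F(v),\dots,F^{p}(v)=v$ ($p\ge1$) of internal vertices of $T^X$; it is *not post-critically finite* if one of the spheres $\mathcal S_{F^j(v)}$ contains a critical point with infinite orbit. **Theorem 3.8 (Spheres periodic cycles), with Theorem 1.** Let $(\mathcal F,\mathcal T^X)$ be a dynamical system of topological trees of spheres, and let $D=\deg(\mathcal F)$. Then the number of grand orbits containing a critical point with infinite forward orbit is at most $2D-2$. Moreover, $(\mathcal F,\mathcal T^X)$ has at most $2D-2$ cycles of spheres that are not post-critically finite. -/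

import Mathlib

namespace SphereTrees

universe u w

/-! ### Topological branched coverings between surfaces -/

/-- A topological space is a two-dimensional topological sphere. -/
def IsTopSphere (M : Type*) [TopologicalSpace M] : Prop :=
  Nonempty (M ≃ₜ Metric.sphere (0 : EuclideanSpace ℝ (Fin 3)) 1)

/-- In suitable complex charts centred at `x` and at `f x`, the map `f` is `z ↦ z ^ n`.
(Since `ψ (f x) = 0 = 0 ^ n`, this forces `n ≠ 0`.) -/
def HasLocalDegree {M N : Type*} [TopologicalSpace M] [TopologicalSpace N]
    (f : M → N) (x : M) (n : ℕ) : Prop :=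
  ∃ (φ : OpenPartialHomeomorph M ℂ) (ψ : OpenPartialHomeomorph N ℂ),
    x ∈ φ.source ∧ φ x = 0 ∧ ψ (f x) = 0 ∧
      ∀ p ∈ φ.source, f p ∈ ψ.source ∧ ψ (f p) = φ p ^ n

/-- A branched covering between surfaces: a continuous map which is locally `z ↦ z ^ n`
everywhere. -/
def IsBranchedCover {M N : Type*} [TopologicalSpace M] [TopologicalSpace N]
    (f : M → N) : Prop :=
  Continuous f ∧ ∀ x, ∃ n, HasLocalDegree f x n

/-- The local degree `deg_x f` (the exponent `n` is unique when it exists). -/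
noncomputable def localDegree {M N : Type*} [TopologicalSpace M] [TopologicalSpace N]
    (f : M → N) (x : M) : ℕ :=
  sInf {n | HasLocalDegree f x n}

/-- `d` is the degree of the branched covering `f`: every point has `d` preimages, counted with
local degrees. -/
def HasTotalDegree {M N : Type*} [TopologicalSpace M] [TopologicalSpace N]
    (f : M → N) (d : ℕ) : Prop :=
  ∀ y, (f ⁻¹' {y}).Finite ∧ ∑ᶠ x ∈ f ⁻¹' {y}, localDegree f x = d

/-! ### Combinatorial trees -/

/-- A finite tree whose vertices are taken in a type `V`. -/
structure CombTree (V : Type u) where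
  verts : Set V
  graph : SimpleGraph V
  finite_verts : verts.Finite
  mem_of_adj : ∀ v v', graph.Adj v v' → v ∈ verts
  connected : ∀ v ∈ verts, ∀ v' ∈ verts, graph.Reachable v v'
  acyclic : graph.IsAcyclic

namespace CombTree

variable {V : Type u} (T : CombTree V)

/-- The number of edges at `v`. -/
noncomputable def valence (v : V) : ℕ := (T.graph.neighborSet v).ncard

def leaves : Set V := {v ∈ T.verts | T.valence v = 1}

def internal : Set V := {v ∈ T.verts | T.valence v ≠ 1}

/-- `a` and `b` are different from `v` and lie in the same connected component of `T - {v}`,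
that is, on the same branch on `v`. -/
def SameBranch (v a b : V) : Prop := ∃ p : T.graph.Walk a b, v ∉ p.support

/-- `v` separates `a`, `b`, `c`: they lie in three distinct connected components
of `T - {v}`. -/
def Separates (v a b c : V) : Prop :=
  (a ∈ T.verts ∧ a ≠ v) ∧ (b ∈ T.verts ∧ b ≠ v) ∧ (c ∈ T.verts ∧ c ≠ v) ∧
    ¬ T.SameBranch v a b ∧ ¬ T.SameBranch v a c ∧ ¬ T.SameBranch v b c

/-- Compatibility of the tree `T` with the tree `T'`. -/
structure Compatible (T T' : CombTree V) : Prop where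
  leaves_subset : T.leaves ⊆ T'.leaves
  internal_subset : T.internal ⊆ T'.internal
  separates_iff : ∀ v ∈ T.verts, ∀ a ∈ T.verts, ∀ b ∈ T.verts, ∀ c ∈ T.verts,
    (T.Separates v a b c ↔ T'.Separates v a b c)

end CombTree

/-! ### Trees of spheres

The spheres come as a family `S v` indexed by the type `V` in which the vertices of all trees are
taken, so that a vertex common to several trees carries the same sphere in each of them. Only the
`S v` for `v` an internal vertex of a tree matter. -/

/-- A stable topological tree of spheres, marked by the set of its leaves, which has at least three
elements. An edge at `v` is given by its other end `v'`, and `attach v v'` is the attaching point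
on `S v` of the edge `{v, v'}`; its values are meaningful only for `v` internal and `v'`
adjacent to `v`. -/
structure TreeOfSpheres (V : Type u) (S : V → Type w) [∀ v, TopologicalSpace (S v)]
    extends CombTree V where
  three_le_leaves : 3 ≤ toCombTree.leaves.ncard
  stable : ∀ v ∈ toCombTree.internal, 3 ≤ toCombTree.valence v
  sphere : ∀ v ∈ toCombTree.internal, IsTopSphere (S v)
  attach : ∀ v : V, V → S v
  attach_injOn : ∀ v ∈ toCombTree.internal, Set.InjOn (attach v) (graph.neighborSet v)

namespace TreeOfSpheres

variable {V : Type u} {S : V → Type w} [∀ v, TopologicalSpace (S v)]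

/-- The set of attaching points on the sphere at `v`. -/
def attachingPoints (T : TreeOfSpheres V S) (v : V) : Set (S v) :=
  T.attach v '' T.graph.neighborSet v

/-- Compatibility `T ◁ T'` of trees of spheres. For `v` internal in `T` and a leaf `x` of `T`, the
attaching point on `S v` of the branch containing `x` is the same in both trees. -/
structure Compatible (T T' : TreeOfSpheres V S) : Prop where
  tree : T.toCombTree.Compatible T'.toCombTree
  attach_eq : ∀ v ∈ T.internal, ∀ x ∈ T.leaves, ∀ e e' : V,
    T.graph.Adj v e → T.SameBranch v e x → T'.graph.Adj v e' → T'.SameBranch v e' x →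
      T.attach v e = T'.attach v e'

end TreeOfSpheres

/-- A cover between trees of spheres. The values of `F` away from the vertices of `TY` and of `f`
away from the internal vertices of `TY` are meaningless. -/
structure Cover {V : Type u} {S : V → Type w} [∀ v, TopologicalSpace (S v)]
    (TY TZ : TreeOfSpheres V S) where
  F : V → V
  map_adj : ∀ v v', TY.graph.Adj v v' → TZ.graph.Adj (F v) (F v')
  map_leaves : ∀ y ∈ TY.leaves, F y ∈ TZ.leaves
  map_internal : ∀ v ∈ TY.internal, F v ∈ TZ.internal
  f : ∀ v, S v → S (F v)
  branchedCover : ∀ v ∈ TY.internal, IsBranchedCover (f v)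
  /-- `f v` restricts to a map between the complements of the attaching points ... -/
  mapsTo : ∀ v ∈ TY.internal,
    Set.MapsTo (f v) (TY.attachingPoints v)ᶜ (TZ.attachingPoints (F v))ᶜ
  /-- ... and this restriction is a covering map. -/
  covering : ∀ (v : V) (hv : v ∈ TY.internal), IsCoveringMap (mapsTo v hv).restrict
  map_attach : ∀ v ∈ TY.internal, ∀ v', TY.graph.Adj v v' →
    f v (TY.attach v v') = TZ.attach (F v) (F v')
  edge_degree : ∀ v ∈ TY.internal, ∀ v' ∈ TY.internal, TY.graph.Adj v v' →
    localDegree (f v) (TY.attach v v') = localDegree (f v') (TY.attach v' v)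

/-- `D` is the degree of the cover: with `deg v` the degree of `f v` for an internal vertex `v` of
the source, and `deg y` the local degree at the attaching point of the edge of `y` for a leaf `y`,
the sum of the degrees of the preimages of each vertex of the target tree is `D`. -/
def Cover.HasDegree {V : Type u} {S : V → Type w} [∀ v, TopologicalSpace (S v)]
    {TY TZ : TreeOfSpheres V S} (C : Cover TY TZ) (D : ℕ) : Prop :=
  ∃ deg : V → ℕ,
    (∀ v ∈ TY.internal, HasTotalDegree (C.f v) (deg v)) ∧
    (∀ y ∈ TY.leaves, ∀ v, TY.graph.Adj v y → deg y = localDegree (C.f v) (TY.attach v y)) ∧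
    ∀ v' ∈ TZ.verts, ∑ᶠ v ∈ {v ∈ TY.verts | C.F v = v'}, deg v = D

/-! ### Dynamics -/

/-- A dynamical system of topological trees of spheres. -/
structure DynSystem (V : Type u) (S : V → Type w) [∀ v, TopologicalSpace (S v)] where
  TX : TreeOfSpheres V S
  TY : TreeOfSpheres V S
  TZ : TreeOfSpheres V S
  cover : Cover TY TZ
  compatible_source : TX.Compatible TY
  compatible_target : TX.Compatible TZ

namespace DynSystem

variable {V : Type u} {S : V → Type w} [∀ v, TopologicalSpace (S v)] (𝓕 : DynSystem V S)

/-- `IV(F ^ k)`: for `k ≥ 1`, the vertices `v` with `v, F v, ..., F ^ (k - 1) v` all internal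
vertices of `TX`. -/
def iterDomain (k : ℕ) : Set V := {v | ∀ j < k, 𝓕.cover.F^[j] v ∈ 𝓕.TX.internal}

/-- `Prep(F)`: the vertices which can be iterated forever. -/
def prep : Set V := {v | ∀ k, v ∈ 𝓕.iterDomain k}

/-- The disjoint union `Σ` of the spheres of `TY`. -/
def points : Set (Σ v, S v) := {z | z.1 ∈ 𝓕.TY.internal}

/-- The map given on the sphere at `v` by `f v`. -/
def step (z : Σ v, S v) : Σ v, S v := ⟨𝓕.cover.F z.1, 𝓕.cover.f z.1 z.2⟩

/-- The forward orbit of a point: its images under the iterates that are defined. -/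
def orbit (z : Σ v, S v) : Set (Σ v, S v) :=
  {z' | ∃ k, z.1 ∈ 𝓕.iterDomain k ∧ 𝓕.step^[k] z = z'}

/-- The grand orbit of `z`: the points of `Σ` whose orbit meets that of `z`. -/
def grandOrbit (z : Σ v, S v) : Set (Σ v, S v) :=
  {z' ∈ 𝓕.points | (𝓕.orbit z ∩ 𝓕.orbit z').Nonempty}

def IsCritical (z : Σ v, S v) : Prop :=
  z ∈ 𝓕.points ∧ 1 < localDegree (𝓕.cover.f z.1) z.2

/-- The set of grand orbits containing a critical point with infinite forward orbit. -/
def infiniteCriticalGrandOrbits : Set (Set (Σ v, S v)) :=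
  {G | (∃ z ∈ 𝓕.points, G = 𝓕.grandOrbit z) ∧
    ∃ c ∈ G, 𝓕.IsCritical c ∧ (𝓕.orbit c).Infinite}

/-- A cycle of spheres, given as the set of its vertices: the orbit of a periodic vertex
of `Prep(F)`. -/
def IsCycle (C : Set V) : Prop :=
  ∃ v ∈ 𝓕.prep, (∃ p, 0 < p ∧ 𝓕.cover.F^[p] v = v) ∧ C = {v' | ∃ k, 𝓕.cover.F^[k] v = v'}

/-- The set of cycles of spheres which are not post-critically finite. -/
def nonPostcriticallyFiniteCycles : Set (Set V) :=
  {C | 𝓕.IsCycle C ∧ ∃ c, c.1 ∈ C ∧ 𝓕.IsCritical c ∧ (𝓕.orbit c).Infinite}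

end DynSystem

end SphereTrees

/-!
All critical points of the cover are attaching points: off these the sphere maps are coverings.
A grand orbit containing a critical point with infinite forward orbit is charged to a leaf of `TZ`
which is a critical value, and two facts give the bound: a cover of degree `D` has at most
`2 * D - 2` critical leaves, and different grand orbits can be charged to different leaves.

**Counting critical leaves.** At each internal vertex of `TY` the Riemann–Hurwitz inequality
`riemannHurwitz_le` holds; summed over the vertices of `TY`, with the Euler characteristic of the
trees `TY` and `TZ`, it gives `Cover.ncard_criticalValueLeaves_add_two_le`. The inequality only
needs that the first cohomology of the plane minus `n` points has rank at most `n`. In the target,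
seen from one of the points of `P` as a plane, the remaining points of `P` are sorted by a linear
functional, and the strips between consecutive ones are evenly covered. For each sheet over a
strip there is a circle-valued function on the source that turns once across this sheet. The
winding numbers at the punctures are linear in such a family, and a combination without winding
has a real logarithm (`exists_log_of_local_log`), hence is the coboundary of an integer-valued
function on the preimages of the sorted points (`card_add_one_le_of_log`).

**Branches without critical values.** Over a branch of `TZ` that contains no critical value leaf
the cover is unramified, and each branch of `TY` at an edge over its root edge is mapped into it
(`Cover.edgeDegree_eq_one_of_branch`). This is an induction from the leaves inwards; it uses that
a branched covering of a sphere which is unramified away from one point of the target has degree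
one (`HasTotalDegree.eq_one`).

**Dynamics.** The image of a critical point is the attaching point of a branch of `TZ` that
contains a critical value leaf. Since there are finitely many attaching points, an infinite orbit
visits such branches a last time. From then on, a vertex with infinite itinerary in the branch
visited would be carried along by the orbit, which would meet attaching points forever; so there
is none (`DynSystem.exists_critical_branch`). Two branches with this property which share a leaf
coincide, and then the two orbits meet. Hence the critical value leaves in the last branches of
different grand orbits are different. Finally, a cycle that is not post-critically finite is
determined by the grand orbit of a critical point on it.
-/

namespace SphereTrees

open Set Topology

/-! ### Local degrees -/

section LocalDegree

variable {M N : Type*} [TopologicalSpace M] [TopologicalSpace N] {f : M → N} {x : M} {n : ℕ}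

theorem HasLocalDegree.ne_zero (h : HasLocalDegree f x n) : n ≠ 0 := by
  rintro rfl
  obtain ⟨φ, ψ, hx, h0, h0', H⟩ := h
  have := (H x hx).2
  simp [h0'] at this

theorem HasLocalDegree.exists_ne_mem (h : HasLocalDegree f x n) {V : Set N} (hV : V ∈ 𝓝 (f x)) :
    ∃ y ∈ V, y ≠ f x := by
  obtain ⟨φ, ψ, hx, h0, h0', H⟩ := h
  have hs := (H x hx).1
  have h1 : ψ.symm ⁻¹' V ∈ 𝓝 (0 : ℂ) := by
    have := ψ.continuousAt_symm (x := 0) (by rw [← h0']; exact ψ.map_source hs)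
    apply this
    rwa [← h0', ψ.left_inv hs]
  have h2 : ψ.target ∈ 𝓝 (0 : ℂ) := ψ.open_target.mem_nhds (by rw [← h0']; exact ψ.map_source hs)
  have h3 : ∀ᶠ z in 𝓝[≠] (0 : ℂ), z ∈ ψ.symm ⁻¹' V ∩ ψ.target ∧ z ≠ 0 :=
    (Filter.Eventually.filter_mono nhdsWithin_le_nhds (Filter.inter_mem h1 h2)).and
      self_mem_nhdsWithin
  obtain ⟨z, hz, hz0⟩ := h3.exists
  refine ⟨ψ.symm z, hz.1, fun h => hz0 ?_⟩
  rw [← ψ.right_inv hz.2, h, h0']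

theorem ncard_setOf_pow_eq {w : ℂ} (hw : w ≠ 0) (hn : n ≠ 0) : {z : ℂ | z ^ n = w}.ncard = n := by
  have hp := Complex.isPrimitiveRoot_exp n hn
  obtain ⟨a, ha⟩ : ∃ a : ℂ, a ^ n = w := ⟨_, Complex.cpow_nat_inv_pow w hn⟩
  have hnd := hp.nthRoots_nodup (a := w) hw
  have hc : Multiset.card (Polynomial.nthRoots n w) = n := by
    rw [hp.card_nthRoots, if_pos ⟨a, ha⟩]
  have : {z : ℂ | z ^ n = w} = ((⟨Polynomial.nthRoots n w, hnd⟩ : Finset ℂ) : Set ℂ) := by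
    ext z
    simp [Polynomial.mem_nthRoots (Nat.pos_of_ne_zero hn)]
  rw [this, ncard_coe_finset]
  exact hc

/-- The charts of a local normal form `z ↦ z ^ n` at `x` also give a local normal form `z ↦ z` at
every other point of the domain. -/
theorem HasLocalDegree.one_of_chart {φ : OpenPartialHomeomorph M ℂ} {ψ : OpenPartialHomeomorph N ℂ}
    (hn : n ≠ 0) (H : ∀ p ∈ φ.source, f p ∈ ψ.source ∧ ψ (f p) = φ p ^ n) {p : M}
    (hp : p ∈ φ.source) (hp0 : φ p ≠ 0) : HasLocalDegree f p 1 := by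
  have hd : HasStrictDerivAt (fun z : ℂ => z ^ n) (n * φ p ^ (n - 1)) (φ p) := by
    simpa using hasStrictDerivAt_pow n (φ p)
  have hne : (n * φ p ^ (n - 1) : ℂ) ≠ 0 := by
    simp [hn, hp0]
  let e := (hd.hasStrictFDerivAt_equiv hne).toOpenPartialHomeomorph (fun z : ℂ => z ^ n)
  have he : φ p ∈ e.source := (hd.hasStrictFDerivAt_equiv hne).mem_toOpenPartialHomeomorph_source
  have hez : ∀ z, e z = z ^ n := fun z => rfl
  let t : ℂ ≃ₜ ℂ := Homeomorph.addRight (-(φ p ^ n))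
  have ht : ∀ z, t z = z - φ p ^ n := fun z => (sub_eq_add_neg _ _).symm
  refine ⟨(φ.trans e).transHomeomorph t, ψ.transHomeomorph t, ?_, ?_, ?_, ?_⟩
  · simp [hp, he]
  · simp [ht, hez]
  · simp [ht, (H p hp).2]
  · intro q hq
    have hq' : q ∈ φ.source := by simp at hq; exact hq.1
    refine ⟨by simpa using (H q hq').1, ?_⟩
    simp [ht, hez, (H q hq').2]

/-- A map of local degree `n` at `x` is `n`-to-one near `x`, away from `x`, and has local degree one
there. -/
theorem HasLocalDegree.exists_nhds (h : HasLocalDegree f x n) {W : Set M} (hW : W ∈ 𝓝 x) :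
    ∃ U V, IsOpen U ∧ IsOpen V ∧ x ∈ U ∧ f x ∈ V ∧ U ⊆ W ∧ (∀ p ∈ U, f p = f x → p = x) ∧
      (∀ y ∈ V, y ≠ f x → (U ∩ f ⁻¹' {y}).ncard = n) ∧
      ∀ p ∈ U, p ≠ x → HasLocalDegree f p 1 := by
  have hn := h.ne_zero
  obtain ⟨φ, ψ, hx, h0, h0', H⟩ := h
  have hs := (H x hx).1
  have h0t : (0 : ℂ) ∈ φ.target := h0 ▸ φ.map_source hx
  have h0t' : (0 : ℂ) ∈ ψ.target := h0' ▸ ψ.map_source hs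
  have h1 : φ.symm ⁻¹' W ∩ φ.target ∈ 𝓝 (0 : ℂ) := by
    refine Filter.inter_mem (φ.continuousAt_symm h0t ?_) (φ.open_target.mem_nhds h0t)
    rwa [← h0, φ.left_inv hx]
  obtain ⟨δ, hδ, hball⟩ := Metric.mem_nhds_iff.1 h1
  have hbt : Metric.ball (0 : ℂ) δ ⊆ φ.target := fun z hz => (hball hz).2
  have key : ∀ p ∈ φ.source, f p = f x → p = x := by
    intro p hp hpx
    have h2 := (H p hp).2
    rw [hpx, h0', eq_comm, pow_eq_zero_iff hn, ← h0] at h2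
    exact φ.injOn hp hx h2
  refine ⟨φ.source ∩ φ ⁻¹' Metric.ball 0 δ, ψ.source ∩ ψ ⁻¹' Metric.ball 0 (δ ^ n),
    φ.isOpen_inter_preimage Metric.isOpen_ball, ψ.isOpen_inter_preimage Metric.isOpen_ball,
    ⟨hx, by simp [h0, hδ]⟩, ⟨hs, by simp [h0', hδ]⟩, ?_, ?_, ?_, ?_⟩
  · rintro p ⟨hp, hpb⟩
    have := (hball hpb).1
    rwa [mem_preimage, φ.left_inv hp] at this
  · rintro p ⟨hp, -⟩
    exact key p hp
  · rintro y ⟨hy, hyb⟩ hyx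
    have hy0 : ψ y ≠ 0 := fun h => hyx (ψ.injOn hy hs (h.trans h0'.symm))
    rw [← ncard_setOf_pow_eq hy0 hn]
    have hinj : InjOn φ ((φ.source ∩ φ ⁻¹' Metric.ball 0 δ) ∩ f ⁻¹' {y}) :=
      φ.injOn.mono fun p hp => hp.1.1
    rw [← hinj.ncard_image]
    congr 1
    ext z
    constructor
    · rintro ⟨p, ⟨⟨hp, -⟩, hpy⟩, rfl⟩
      rw [mem_ofPred_eq, ← (H p hp).2, show f p = y from hpy]
    · intro hz
      have hz : z ^ n = ψ y := hz
      have hzb : z ∈ Metric.ball (0 : ℂ) δ := by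
        rw [mem_ball_zero_iff]
        rw [mem_preimage, mem_ball_zero_iff, ← hz, norm_pow] at hyb
        exact lt_of_pow_lt_pow_left₀ n hδ.le hyb
      have hzt := hbt hzb
      have hzs := φ.map_target hzt
      refine ⟨φ.symm z, ⟨⟨hzs, ?_⟩, ?_⟩, φ.right_inv hzt⟩
      · rwa [mem_preimage, φ.right_inv hzt]
      · refine ψ.injOn (H _ hzs).1 hy ?_
        rw [(H _ hzs).2, φ.right_inv hzt, hz]
  · rintro p ⟨hp, -⟩ hpx
    refine HasLocalDegree.one_of_chart hn H hp fun h => hpx (φ.injOn hp hx (h.trans h0.symm))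

theorem HasLocalDegree.le {m : ℕ} (h : HasLocalDegree f x n) (h' : HasLocalDegree f x m) :
    m ≤ n := by
  obtain ⟨U, V, hU, hV, hxU, hxV, -, -, hc, -⟩ := h.exists_nhds Filter.univ_mem
  obtain ⟨U', V', hU', hV', hxU', hxV', hUU, -, hc', -⟩ := h'.exists_nhds (hU.mem_nhds hxU)
  obtain ⟨y, hy, hyx⟩ := h.exists_ne_mem ((hV.inter hV').mem_nhds ⟨hxV, hxV'⟩)
  rw [← hc y hy.1 hyx, ← hc' y hy.2 hyx]
  refine ncard_le_ncard (inter_subset_inter_left _ hUU) (finite_of_ncard_ne_zero ?_)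
  rw [hc y hy.1 hyx]
  exact h.ne_zero

theorem HasLocalDegree.localDegree_eq (h : HasLocalDegree f x n) : localDegree f x = n := by
  have : {k | HasLocalDegree f x k} = {n} := by
    ext k
    refine ⟨fun hk => le_antisymm (h.le hk) (HasLocalDegree.le hk h), ?_⟩
    rintro rfl
    exact h
  rw [localDegree, this, csInf_singleton]

theorem IsBranchedCover.hasLocalDegree (hf : IsBranchedCover f) (x : M) :
    HasLocalDegree f x (localDegree f x) := by
  obtain ⟨n, hn⟩ := hf.2 x
  rwa [hn.localDegree_eq]

theorem IsBranchedCover.localDegree_pos (hf : IsBranchedCover f) (x : M) : 0 < localDegree f x :=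
  Nat.pos_of_ne_zero (hf.hasLocalDegree x).ne_zero

theorem localDegree_eq_one_of_injOn (hf : IsBranchedCover f) {W : Set M} (hW : W ∈ 𝓝 x)
    (hinj : InjOn f W) : localDegree f x = 1 := by
  obtain ⟨U, V, hU, hV, hxU, hxV, hUW, -, hc, -⟩ := (hf.hasLocalDegree x).exists_nhds hW
  obtain ⟨y, hy, hyx⟩ := (hf.hasLocalDegree x).exists_ne_mem (hV.mem_nhds hxV)
  have h1 : (U ∩ f ⁻¹' {y}).ncard ≤ 1 := by
    rw [ncard_le_one (finite_of_ncard_ne_zero (by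
      rw [hc y hy hyx]
      exact (hf.localDegree_pos x).ne'))]
    rintro a ⟨ha, hay⟩ b ⟨hb, hby⟩
    exact hinj (hUW ha) (hUW hb) (hay.trans hby.symm)
  rw [hc y hy hyx] at h1
  have := hf.localDegree_pos x
  omega

theorem HasLocalDegree.exists_openPartialHomeomorph (h : HasLocalDegree f x 1) :
    ∃ e : OpenPartialHomeomorph M N, x ∈ e.source ∧ EqOn f e e.source := by
  obtain ⟨φ, ψ, hx, h0, h0', H⟩ := h
  have hs := (H x hx).1
  refine ⟨φ.trans ψ.symm, ?_, ?_⟩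
  · simp only [OpenPartialHomeomorph.trans_source, mem_inter_iff, hx, true_and, mem_preimage,
      OpenPartialHomeomorph.symm_source]
    rw [h0, ← h0']
    exact ψ.map_source hs
  · intro p hp
    have hp' : p ∈ φ.source := hp.1
    have h2 := (H p hp').2
    rw [pow_one] at h2
    simp only [OpenPartialHomeomorph.coe_trans, Function.comp]
    rw [← h2, ψ.left_inv (H p hp').1]

theorem IsBranchedCover.isLocalHomeomorphOn (hf : IsBranchedCover f) :
    IsLocalHomeomorphOn f {x | localDegree f x = 1} := by
  refine IsLocalHomeomorphOn.mk _ _ fun x hx => ?_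
  have h := hf.hasLocalDegree x
  rw [show localDegree f x = 1 from hx] at h
  exact h.exists_openPartialHomeomorph

theorem IsBranchedCover.isCoveringMapOn [CompactSpace M] [T2Space M] [T2Space N]
    (hf : IsBranchedCover f) {s : Set N} (hs : ∀ x, f x ∈ s → localDegree f x = 1) :
    IsCoveringMapOn f s :=
  IsCoveringMapOn.of_isLocalHomeomorphOn hf.1 fun x hx => hf.isLocalHomeomorphOn x (hs x hx)

/-! ### The degree of a branched covering -/

theorem IsBranchedCover.finite_fiber [CompactSpace M] [T1Space N] (hf : IsBranchedCover f)
    (y : N) : (f ⁻¹' {y}).Finite := by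
  have hcl : IsClosed (f ⁻¹' {y}) := isClosed_singleton.preimage hf.1
  refine hcl.isCompact.finite (isDiscrete_iff_forall_mem_exists_isOpen.mpr fun x hx => ?_)
  obtain ⟨U, V, hU, hV, hxU, hxV, -, h1, -⟩ := (hf.hasLocalDegree x).exists_nhds Filter.univ_mem
  refine ⟨U, hU, ?_⟩
  ext p
  simp only [mem_inter_iff, mem_singleton_iff]
  constructor
  · rintro ⟨hp, hpy⟩
    exact h1 p hp ((show f p = y from hpy).trans (show f x = y from hx).symm)
  · rintro rfl
    exact ⟨hxU, hx⟩

theorem HasLocalDegree.exists_nhds_finsum (hf : IsBranchedCover f) (x : M) {W : Set M}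
    (hW : W ∈ 𝓝 x) :
    ∃ U V, IsOpen U ∧ IsOpen V ∧ x ∈ U ∧ f x ∈ V ∧ U ⊆ W ∧
      ∀ y ∈ V, ∑ᶠ p ∈ U ∩ f ⁻¹' {y}, localDegree f p = localDegree f x := by
  obtain ⟨U, V, hU, hV, hxU, hxV, hUW, h1, hc, h2⟩ := (hf.hasLocalDegree x).exists_nhds hW
  refine ⟨U, V, hU, hV, hxU, hxV, hUW, fun y hy => ?_⟩
  by_cases hyx : y = f x
  · have : U ∩ f ⁻¹' {y} = {x} := by
      ext p
      simp only [mem_inter_iff, mem_preimage, mem_singleton_iff]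
      exact ⟨fun h => h1 p h.1 (h.2.trans hyx), by rintro rfl; exact ⟨hxU, hyx.symm⟩⟩
    rw [this, finsum_mem_singleton]
  · rw [← hc y hy hyx, ← finsum_one]
    refine finsum_mem_congr rfl fun p hp => (h2 p hp.1 ?_).localDegree_eq
    rintro rfl
    exact hyx (show f p = y from hp.2).symm

theorem IsBranchedCover.exists_hasTotalDegree [CompactSpace M] [T2Space M] [T2Space N]
    [ConnectedSpace N] (hf : IsBranchedCover f) : ∃ d, HasTotalDegree f d := by
  have hloc : IsLocallyConstant fun y => ∑ᶠ x ∈ f ⁻¹' {y}, localDegree f x := by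
    rw [IsLocallyConstant.iff_eventually_eq]
    intro y₀
    have hfin := hf.finite_fiber y₀
    obtain ⟨W, hW, hdisj⟩ := hfin.t2_separation
    choose U V hU hV hxU hxV hUW hsum using fun x =>
      HasLocalDegree.exists_nhds_finsum hf x ((hW x).2.mem_nhds (hW x).1)
    have hclosed : IsClosed (f '' (⋃ x ∈ f ⁻¹' {y₀}, U x)ᶜ) :=
      hf.1.isClosedMap _ (isOpen_biUnion fun x _ => hU x).isClosed_compl
    have hy₀ : y₀ ∉ f '' (⋃ x ∈ f ⁻¹' {y₀}, U x)ᶜ := by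
      rintro ⟨x, hx, hxy⟩
      exact hx (mem_biUnion (show x ∈ f ⁻¹' {y₀} from hxy) (hxU x))
    have hev : ∀ᶠ y in 𝓝 y₀, ∀ x ∈ f ⁻¹' {y₀}, y ∈ V x := by
      refine (Filter.eventually_all_finite hfin).2 fun x hx => (hV x).mem_nhds ?_
      rw [← show f x = y₀ from hx]
      exact hxV x
    filter_upwards [hev, hclosed.isOpen_compl.mem_nhds hy₀] with y hy hyn
    have hset : f ⁻¹' {y} = ⋃ x ∈ f ⁻¹' {y₀}, U x ∩ f ⁻¹' {y} := by
      ext p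
      simp only [mem_iUnion, mem_inter_iff, exists_prop]
      refine ⟨fun hp => ?_, fun ⟨x, _, _, hp⟩ => hp⟩
      by_contra hcon
      refine hyn ⟨p, fun hpU => hcon ?_, hp⟩
      obtain ⟨x, hx, hpx⟩ := mem_iUnion₂.1 hpU
      exact ⟨x, hx, hpx, hp⟩
    rw [hset, finsum_mem_biUnion]
    · exact finsum_mem_congr rfl fun x hx => hsum x y (hy x hx)
    · intro x hx x' hx' hne
      exact (hdisj hx hx' hne).mono (fun p hp => hUW x hp.1) (fun p hp => hUW x' hp.1)
    · exact hfin
    · exact fun x _ => (hf.finite_fiber y).subset inter_subset_right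
  obtain ⟨y₀⟩ := (inferInstance : Nonempty N)
  exact ⟨∑ᶠ x ∈ f ⁻¹' {y₀}, localDegree f x, fun y =>
    ⟨hf.finite_fiber y, hloc.apply_eq_of_isPreconnected isPreconnected_univ trivial trivial⟩⟩

theorem HasTotalDegree.pos [Nonempty M] {d : ℕ} (hf : IsBranchedCover f)
    (hd : HasTotalDegree f d) : 0 < d := by
  obtain ⟨x⟩ := (inferInstance : Nonempty M)
  obtain ⟨hfin, hsum⟩ := hd (f x)
  rw [← hsum]
  refine lt_of_lt_of_le (hf.localDegree_pos x) ?_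
  rw [finsum_mem_eq_finite_toFinset_sum _ hfin]
  exact Finset.single_le_sum (f := fun x => localDegree f x) (fun _ _ => Nat.zero_le _) (by simp)

theorem HasTotalDegree.surjective {d : ℕ} (hd : HasTotalDegree f d) (hd0 : 0 < d) :
    Function.Surjective f := by
  intro y
  by_contra hcon
  have : f ⁻¹' {y} = ∅ := by
    ext p
    simpa using fun h => hcon ⟨p, h⟩
  have h := (hd y).2
  rw [this, finsum_mem_empty] at h
  omega

theorem HasTotalDegree.ncard_fiber {d : ℕ} (hd : HasTotalDegree f d) {y : N}
    (hy : ∀ x, f x = y → localDegree f x = 1) : (f ⁻¹' {y}).ncard = d := by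
  rw [← (hd y).2, ← finsum_one]
  exact (finsum_mem_congr rfl fun x hx => hy x hx).symm

end LocalDegree

/-! ### Topological spheres -/

section Sphere

variable {M : Type*} [TopologicalSpace M]

theorem IsTopSphere.compactSpace (h : IsTopSphere M) : CompactSpace M := by
  obtain ⟨e⟩ := h
  exact e.symm.compactSpace

theorem IsTopSphere.t2Space (h : IsTopSphere M) : T2Space M := by
  obtain ⟨e⟩ := h
  exact e.symm.t2Space

theorem IsTopSphere.connectedSpace (h : IsTopSphere M) : ConnectedSpace M := by
  obtain ⟨e⟩ := h
  have : IsConnected (Metric.sphere (0 : EuclideanSpace ℝ (Fin 3)) 1) := by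
    refine isConnected_sphere ?_ 0 zero_le_one
    rw [← Module.finrank_eq_rank]
    simp
  have := isConnected_iff_connectedSpace.1 this
  exact e.symm.surjective.connectedSpace e.symm.continuous

/-- The complement of a point of a sphere is homeomorphic to the plane. -/
theorem IsTopSphere.exists_plane (h : IsTopSphere M) (x : M) :
    ∃ e : OpenPartialHomeomorph M ℂ, e.source = {x}ᶜ ∧ e.target = univ := by
  obtain ⟨e⟩ := h
  have : Fact (Module.finrank ℝ (EuclideanSpace ℝ (Fin 3)) = 2 + 1) := ⟨by simp⟩
  let t : EuclideanSpace ℝ (Fin 2) ≃ₜ ℂ := Complex.orthonormalBasisOneI.repr.symm.toHomeomorph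
  refine ⟨e.toOpenPartialHomeomorph.trans ((stereographic' 2 (e x)).transHomeomorph t), ?_, ?_⟩
  · ext y
    simp
  · simp

end Sphere

/-! ### Lifting over convex sets, and real logarithms of circle-valued maps -/

theorem exists_lift_of_convex {E B : Type*} [TopologicalSpace E] [TopologicalSpace B] {p : E → B}
    {s : Set B} (cov : IsCoveringMapOn p s) {K : Set ℂ} (hK : Convex ℝ K) {h : ℂ → B}
    (hc : ContinuousOn h K) (hs : MapsTo h K s) {a : ℂ} (ha : a ∈ K) {e : E} (he : p e = h a) :
    ∃ σ : ℂ → E, ContinuousOn σ K ∧ σ a = e ∧ ∀ z ∈ K, p (σ z) = h z := by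
  classical
  have := hK.contractibleSpace ⟨a, ha⟩
  have := hK.locallyPathConnectedSpace
  obtain ⟨F, ⟨hF, hF'⟩, -⟩ := cov.existsUnique_continuousMap_lifts
    (⟨fun z : K => h z, continuousOn_iff_continuous_domRestrict.1 hc⟩ : C(K, B)) (a₀ := ⟨a, ha⟩)
    he (fun z => hs z.2)
  refine ⟨fun z => if hz : z ∈ K then F ⟨z, hz⟩ else e, ?_, by simp [ha, hF], fun z hz => ?_⟩
  · rw [continuousOn_iff_continuous_domRestrict]
    convert F.continuous using 1
    ext z
    simp
  · simp only [hz, dif_pos]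
    exact congrFun hF' ⟨z, hz⟩

theorem exists_log_of_convex {K : Set ℂ} (hK : Convex ℝ K) {h : ℂ → AddCircle (1 : ℝ)}
    (hc : ContinuousOn h K) :
    ∃ H : ℂ → ℝ, ContinuousOn H K ∧ ∀ z ∈ K, (H z : AddCircle (1 : ℝ)) = h z := by
  rcases K.eq_empty_or_nonempty with rfl | ⟨a, ha⟩
  · exact ⟨0, by simp, by simp⟩
  obtain ⟨t, ht⟩ := QuotientAddGroup.mk_surjective (h a)
  obtain ⟨H, h1, -, h2⟩ := exists_lift_of_convex (AddCircle.isCoveringMap_coe (1 : ℝ)).isCoveringMapOn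
    hK hc (mapsTo_univ _ _) ha ht
  exact ⟨H, h1, h2⟩

theorem coe_eq_zero_iff_exists_int (t : ℝ) :
    ((t : ℝ) : AddCircle (1 : ℝ)) = 0 ↔ ∃ n : ℤ, t = n := by
  rw [AddCircle.coe_eq_zero_iff]
  simp [eq_comm]

theorem eqOn_of_int_valued {X : Type*} [TopologicalSpace X] {S : Set X} (hS : IsPreconnected S)
    {H : X → ℝ} (hc : ContinuousOn H S)
    (hint : ∀ x ∈ S, ((H x : ℝ) : AddCircle (1 : ℝ)) = 0) {x y : X} (hx : x ∈ S) (hy : y ∈ S) :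
    H x = H y :=
  (AddCircle.isCoveringMap_coe (1 : ℝ)).constOn_of_comp hS hc
    (fun a ha b hb => (hint a ha).trans (hint b hb).symm) hx hy

/-! ### Winding numbers at a puncture of the plane -/

/-- The half-plane that `s ↦ q + exp s` wraps around the punctured disc of radius `ε` at `q`. -/
def halfPlane (ε : ℝ) : Set ℂ := {s | s.re < Real.log ε}

theorem convex_halfPlane (ε : ℝ) : Convex ℝ (halfPlane ε) :=
  convex_halfSpace_re_lt _

theorem add_exp_mem {q : ℂ} {ε : ℝ} (hε : 0 < ε) {s : ℂ} (hs : s ∈ halfPlane ε) :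
    q + Complex.exp s ∈ Metric.ball q ε \ {q} := by
  refine ⟨?_, by simp [Complex.exp_ne_zero]⟩
  rw [mem_ball_iff_norm, add_sub_cancel_left, Complex.norm_exp]
  exact (Real.lt_log_iff_exp_lt hε).1 hs

theorem log_mem_halfPlane {q : ℂ} {ε : ℝ} {z : ℂ} (hz : z ∈ Metric.ball q ε \ {q}) :
    Complex.log (z - q) ∈ halfPlane ε ∧ q + Complex.exp (Complex.log (z - q)) = z := by
  have hz0 : z - q ≠ 0 := sub_ne_zero.2 hz.2
  refine ⟨?_, by rw [Complex.exp_log hz0]; ring⟩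
  rw [halfPlane, mem_ofPred_eq, Complex.log_re]
  exact Real.log_lt_log (norm_pos_iff.2 hz0) (mem_ball_iff_norm.1 hz.1)

theorem add_two_pi_mem_halfPlane {ε : ℝ} {s : ℂ} (hs : s ∈ halfPlane ε) (n : ℤ) :
    s + n * (2 * Real.pi * Complex.I) ∈ halfPlane ε := by
  have : (s + n * (2 * Real.pi * Complex.I)).re = s.re := by simp
  rwa [halfPlane, mem_ofPred_eq, this]

/-- `n` is the winding number at `q` of the circle-valued map `h` on the punctured disc of radius
`ε`: a logarithm of `h` along `s ↦ q + exp s` increases by `n` over the period `2πi`. -/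
def HasWinding (h : ℂ → AddCircle (1 : ℝ)) (q : ℂ) (ε : ℝ) (n : ℤ) : Prop :=
  ∃ H : ℂ → ℝ, ContinuousOn H (halfPlane ε) ∧
    (∀ s ∈ halfPlane ε, (H s : AddCircle (1 : ℝ)) = h (q + Complex.exp s)) ∧
    ∀ s ∈ halfPlane ε, H (s + 2 * Real.pi * Complex.I) = H s + n

section Winding

variable {h h' : ℂ → AddCircle (1 : ℝ)} {q : ℂ} {ε : ℝ} {n n' : ℤ}

theorem exists_hasWinding (hε : 0 < ε) (hc : ContinuousOn h (Metric.ball q ε \ {q})) :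
    ∃ n, HasWinding h q ε n := by
  have hcont : ContinuousOn (fun s => h (q + Complex.exp s)) (halfPlane ε) :=
    hc.comp (by fun_prop) fun s hs => add_exp_mem hε hs
  obtain ⟨H, hH, hlog⟩ := exists_log_of_convex (convex_halfPlane ε) hcont
  have hmem : ∀ s ∈ halfPlane ε, s + 2 * Real.pi * Complex.I ∈ halfPlane ε := fun s hs => by
    simpa using add_two_pi_mem_halfPlane hs 1
  have hdiff : ∀ s ∈ halfPlane ε,
      ((H (s + 2 * Real.pi * Complex.I) - H s : ℝ) : AddCircle (1 : ℝ)) = 0 := fun s hs => by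
    rw [AddCircle.coe_sub, hlog s hs, hlog _ (hmem s hs), Complex.exp_add,
      Complex.exp_two_pi_mul_I, mul_one, sub_self]
  have hs₀ : ((Real.log ε - 1 : ℝ) : ℂ) ∈ halfPlane ε := by simp [halfPlane]
  obtain ⟨n, hn⟩ := (coe_eq_zero_iff_exists_int _).1 (hdiff _ hs₀)
  refine ⟨n, H, hH, hlog, fun s hs => ?_⟩
  have := eqOn_of_int_valued (convex_halfPlane ε).isPreconnected
    (H := fun s => H (s + 2 * Real.pi * Complex.I) - H s)
    ((hH.comp (by fun_prop) hmem).sub hH) hdiff hs hs₀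
  linarith

theorem HasWinding.unique (hn : HasWinding h q ε n) (hn' : HasWinding h q ε n') : n = n' := by
  obtain ⟨H, hH, hlog, hper⟩ := hn
  obtain ⟨H', hH', hlog', hper'⟩ := hn'
  have hs₀ : ((Real.log ε - 1 : ℝ) : ℂ) ∈ halfPlane ε := by simp [halfPlane]
  have hs₁ : ((Real.log ε - 1 : ℝ) : ℂ) + 2 * Real.pi * Complex.I ∈ halfPlane ε := by
    simpa using add_two_pi_mem_halfPlane hs₀ 1
  have := eqOn_of_int_valued (convex_halfPlane ε).isPreconnected (H := fun s => H s - H' s)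
    (hH.sub hH') (fun s hs => by rw [AddCircle.coe_sub, hlog s hs, hlog' s hs, sub_self]) hs₀ hs₁
  simp only [hper _ hs₀, hper' _ hs₀] at this
  have h2 : (n : ℝ) = n' := by linarith
  exact_mod_cast h2

theorem HasWinding.add (hn : HasWinding h q ε n) (hn' : HasWinding h' q ε n') :
    HasWinding (h + h') q ε (n + n') := by
  obtain ⟨H, hH, hlog, hper⟩ := hn
  obtain ⟨H', hH', hlog', hper'⟩ := hn'
  refine ⟨H + H', hH.add hH', fun s hs => ?_, fun s hs => ?_⟩
  · simp [hlog s hs, hlog' s hs]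
  · simp only [Pi.add_apply, hper s hs, hper' s hs]
    push_cast
    ring

theorem HasWinding.exists_log (hε : 0 < ε) (h0 : HasWinding h q ε 0) :
    ∃ H : ℂ → ℝ, ContinuousOn H (Metric.ball q ε \ {q}) ∧
      ∀ z ∈ Metric.ball q ε \ {q}, (H z : AddCircle (1 : ℝ)) = h z := by
  obtain ⟨H, hH, hlog, hper⟩ := h0
  have hperN : ∀ n : ℕ, ∀ s ∈ halfPlane ε, H (s + n * (2 * Real.pi * Complex.I)) = H s := by
    intro n
    induction n with
    | zero => simp
    | succ n ih =>
      intro s hs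
      have h1 := hper _ (by simpa using add_two_pi_mem_halfPlane hs (n : ℤ))
      rw [ih s hs] at h1
      rw [← show s + n * (2 * Real.pi * Complex.I) + 2 * Real.pi * Complex.I =
        s + (n + 1 : ℕ) * (2 * Real.pi * Complex.I) by push_cast; ring, h1]
      simp
  have hperZ : ∀ n : ℤ, ∀ s ∈ halfPlane ε, H (s + n * (2 * Real.pi * Complex.I)) = H s := by
    intro n s hs
    obtain ⟨m, rfl | rfl⟩ := n.eq_nat_or_neg
    · simpa using hperN m s hs
    · have h1 := hperN m _ (add_two_pi_mem_halfPlane hs (-(m : ℤ)))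
      rw [← h1]
      congr 1
      push_cast
      ring
  have hE : IsOpenMap fun s => q + Complex.exp s :=
    (Homeomorph.addLeft q).isOpenMap.comp Complex.isOpenMap_exp
  have hopen : IsOpen (halfPlane ε) := isOpen_lt Complex.continuous_re continuous_const
  refine ⟨fun z => H (Complex.log (z - q)), fun z hz => ContinuousAt.continuousWithinAt ?_,
    fun z hz => ?_⟩
  · obtain ⟨hs, hsz⟩ := log_mem_halfPlane hz
    set s₀ := Complex.log (z - q) with hs₀
    have hle := hE.nhds_le s₀
    simp only [hsz] at hle
    refine Filter.Tendsto.mono_left (Filter.tendsto_map'_iff.2 ?_) hle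
    have hcont := (hH.continuousAt (hopen.mem_nhds hs)).tendsto
    refine hcont.congr' ?_
    filter_upwards [hopen.mem_nhds hs] with s hs'
    have hex : Complex.exp s = Complex.exp (Complex.log (q + Complex.exp s - q)) := by
      rw [Complex.exp_log (by simp [Complex.exp_ne_zero])]
      ring
    obtain ⟨n, hn⟩ := Complex.exp_eq_exp_iff_exists_int.1 hex
    simp only [Function.comp]
    conv_lhs => rw [hn]
    exact hperZ n _ (log_mem_halfPlane (add_exp_mem hε hs')).1
  · obtain ⟨hs, hsz⟩ := log_mem_halfPlane hz
    rw [hlog _ hs, hsz]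

end Winding

/-- A circle-valued map on the complement of a finite set in the plane which has a logarithm near
each puncture has a global logarithm. -/
theorem exists_log_of_local_log (Q : Finset ℂ) : ∀ h : ℂ → AddCircle (1 : ℝ),
    ContinuousOn h (Q : Set ℂ)ᶜ →
    (∀ q ∈ Q, ∃ ε > 0, ∃ H : ℂ → ℝ, ContinuousOn H (Metric.ball q ε \ {q}) ∧
      ∀ z ∈ Metric.ball q ε \ {q}, (H z : AddCircle (1 : ℝ)) = h z) →
    ∃ H : ℂ → ℝ, ContinuousOn H (Q : Set ℂ)ᶜ ∧
      ∀ z ∈ (Q : Set ℂ)ᶜ, (H z : AddCircle (1 : ℝ)) = h z := by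
  classical
  induction Q using Finset.induction_on with
  | empty =>
    intro h hc _
    simpa using exists_log_of_convex convex_univ (by simpa using hc)
  | insert q Q hq ih =>
    intro h hc hloc
    obtain ⟨ε, hε, G, hG, hGlog⟩ := hloc q (Finset.mem_insert_self _ _)
    -- The logarithm near `q` is subtracted from `h` after a cut-off.
    let ρ : ℂ → ℝ := fun z => max 0 (min 1 (2 - 3 * dist z q / ε))
    have hρ : Continuous ρ := by fun_prop
    have hρ1 : ∀ z, dist z q < ε / 3 → ρ z = 1 := by
      intro z hz
      have : 1 ≤ 2 - 3 * dist z q / ε := by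
        have : 3 * dist z q / ε ≤ 1 := by
          rw [div_le_one hε]
          linarith
        linarith
      simp [ρ, min_eq_left this]
    have hρ0 : ∀ z, 2 * ε / 3 < dist z q → ρ z = 0 := by
      intro z hz
      have h2 : 2 - 3 * dist z q / ε ≤ 0 := by
        have : 2 ≤ 3 * dist z q / ε := by
          rw [le_div_iff₀ hε]
          linarith
        linarith
      exact max_eq_left ((min_le_right _ _).trans h2)
    let g : ℂ → ℝ := fun z => ρ z * G z
    have hg : ∀ z, z ≠ q → ContinuousAt g z := by
      intro z hz
      by_cases hzd : dist z q < ε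
      · refine hρ.continuousAt.mul (hG.continuousAt ?_)
        exact (Metric.isOpen_ball.sdiff isClosed_singleton).mem_nhds ⟨hzd, hz⟩
      · have hev : ∀ᶠ w in 𝓝 z, g w = 0 := by
          have : {w | 2 * ε / 3 < dist w q} ∈ 𝓝 z :=
            (isOpen_lt continuous_const (by fun_prop)).mem_nhds
              (show 2 * ε / 3 < dist z q by linarith)
          filter_upwards [this] with w hw
          simp [g, hρ0 w hw]
        exact (continuousAt_const (y := (0 : ℝ))).congr (hev.mono fun _ h => h.symm)
    let h' : ℂ → AddCircle (1 : ℝ) := fun z => if z = q then 0 else h z - (g z : AddCircle (1 : ℝ))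
    have hcoe : Continuous ((↑) : ℝ → AddCircle (1 : ℝ)) := AddCircle.continuous_mk' 1
    have hh' : ∀ z, z ≠ q → h' z = h z - (g z : AddCircle (1 : ℝ)) := fun z hz => if_neg hz
    have hc' : ContinuousOn h' (Q : Set ℂ)ᶜ := by
      intro z hz
      refine ContinuousAt.continuousWithinAt ?_
      by_cases hzq : z = q
      · subst hzq
        refine (continuousAt_const (y := (0 : AddCircle (1 : ℝ)))).congr ?_
        filter_upwards [Metric.ball_mem_nhds z (show 0 < ε / 3 by positivity)] with w hw
        by_cases hwz : w = z
        · simp [h', hwz]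
        · have hwm : w ∈ Metric.ball z ε \ {z} :=
            ⟨Metric.ball_subset_ball (by linarith) hw, hwz⟩
          rw [hh' w hwz, ← hGlog w hwm]
          simp [g, hρ1 w hw]
      · have hopen : IsOpen ((insert q Q : Finset ℂ) : Set ℂ)ᶜ :=
          (Finset.finite_toSet _).isClosed.isOpen_compl
        have h1 : ContinuousAt h z := hc.continuousAt (hopen.mem_nhds (by
          simp only [Finset.coe_insert, mem_compl_iff, mem_insert_iff, not_or]
          exact ⟨hzq, hz⟩))
        refine (h1.sub (hcoe.continuousAt.comp (hg z hzq))).congr ?_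
        filter_upwards [isOpen_ne.mem_nhds hzq] with w hw
        rw [hh' w hw]
        rfl
    obtain ⟨H, hH, hHlog⟩ := ih h' hc' (by
      intro q' hq'
      have hne : q' ≠ q := fun h => hq (h ▸ hq')
      obtain ⟨ε', hε', G', hG', hGlog'⟩ := hloc q' (Finset.mem_insert_of_mem hq')
      refine ⟨min ε' (dist q' q), lt_min hε' (dist_pos.2 hne), fun z => G' z - g z, ?_, ?_⟩
      · intro z hz
        have hzq : z ≠ q := by
          rintro rfl
          have := (Metric.mem_ball.1 hz.1).trans_le (min_le_right _ _)
          rw [dist_comm] at this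
          exact lt_irrefl _ this
        refine ((hG'.mono ?_) z hz).sub (hg z hzq).continuousWithinAt
        exact sdiff_subset_sdiff_left (Metric.ball_subset_ball (min_le_left _ _))
      · intro z hz
        have hzq : z ≠ q := by
          rintro rfl
          have := (Metric.mem_ball.1 hz.1).trans_le (min_le_right _ _)
          rw [dist_comm] at this
          exact lt_irrefl _ this
        rw [hh' z hzq, AddCircle.coe_sub, hGlog' z
          ⟨Metric.ball_subset_ball (min_le_left _ _) hz.1, hz.2⟩])
    refine ⟨fun z => H z + g z, fun z hz => ?_, fun z hz => ?_⟩
    · simp only [Finset.coe_insert, mem_compl_iff, mem_insert_iff, not_or] at hz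
      have hopen : IsOpen (Q : Set ℂ)ᶜ := (Finset.finite_toSet _).isClosed.isOpen_compl
      exact ((hH.continuousAt (hopen.mem_nhds hz.2)).add (hg z hz.1)).continuousWithinAt
    · simp only [Finset.coe_insert, mem_compl_iff, mem_insert_iff, not_or] at hz
      rw [AddCircle.coe_add, hHlog z hz.2, hh' z hz.1]
      abel

/-! ### Rank count for circle-valued maps on a punctured plane -/

theorem finrank_range_add_ker_int {ι κ : Type*} [Finite ι] [Finite κ]
    (f : (ι → ℤ) →ₗ[ℤ] (κ → ℤ)) :
    Module.finrank ℤ (LinearMap.range f) + Module.finrank ℤ (LinearMap.ker f) = Nat.card ι := by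
  have := Fintype.ofFinite ι
  rw [← (LinearMap.quotKerEquivRange f).finrank_eq, Submodule.finrank_quotient_add_finrank,
    Module.finrank_fintype_fun_eq_card, Nat.card_eq_fintype_card]

/-- If the members of a family of circle-valued maps on a punctured plane that have a logarithm
all come from the image of `δ`, the rank of the family is at most the number of punctures plus the
rank of `δ`. This says that the first cohomology of the plane minus `n` points has rank at
most `n`. -/
theorem card_add_one_le_of_log {ι κ : Type*} [Finite ι] [Finite κ] [Nonempty κ] (Q : Finset ℂ)
    (h : (ι → ℤ) → ℂ → AddCircle (1 : ℝ)) (hadd : ∀ c c', h (c + c') = h c + h c')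
    (hcont : ∀ c, ContinuousOn (h c) (Q : Set ℂ)ᶜ) (δ : (κ → ℤ) →ₗ[ℤ] (ι → ℤ))
    (hδ : δ (fun _ => 1) = 0)
    (hlog : ∀ c, (∃ H : ℂ → ℝ, ContinuousOn H (Q : Set ℂ)ᶜ ∧
      ∀ z ∈ (Q : Set ℂ)ᶜ, (H z : AddCircle (1 : ℝ)) = h c z) → ∃ u, δ u = c) :
    Nat.card ι + 1 ≤ Q.card + Nat.card κ := by
  classical
  have hball : ∀ q : Q, ∃ ε > 0, Metric.ball (q : ℂ) ε \ {(q : ℂ)} ⊆ (Q : Set ℂ)ᶜ := by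
    intro q
    have hopen : IsOpen ((Q.erase q : Finset ℂ) : Set ℂ)ᶜ :=
      (Finset.finite_toSet _).isClosed.isOpen_compl
    obtain ⟨ε, hε, hsub⟩ := Metric.isOpen_iff.1 hopen q (by simp)
    refine ⟨ε, hε, fun z hz hzQ => hsub hz.1 ?_⟩
    rw [Finset.coe_erase]
    exact ⟨hzQ, hz.2⟩
  choose ε hε hsub using hball
  choose n hn using fun (c : ι → ℤ) (q : Q) =>
    exists_hasWinding (h := h c) (hε q) ((hcont c).mono (hsub q))
  have hnadd : ∀ c c', n (c + c') = n c + n c' := by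
    intro c c'
    funext q
    refine HasWinding.unique (hn _ q) ?_
    rw [hadd]
    exact (hn c q).add (hn c' q)
  let w : (ι → ℤ) →ₗ[ℤ] (Q → ℤ) := (AddMonoidHom.mk' n hnadd).toIntLinearMap
  have hw : ∀ c, w c = n c := fun c => rfl
  have hker : LinearMap.ker w ≤ LinearMap.range δ := by
    intro c hc
    have hc0 : n c = 0 := hc
    refine hlog c (exists_log_of_local_log Q (h c) (hcont c) fun q hq => ?_)
    have h0 := hn c ⟨q, hq⟩
    rw [hc0] at h0
    exact ⟨ε ⟨q, hq⟩, hε _, h0.exists_log (hε _)⟩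
  have h1 := finrank_range_add_ker_int w
  have h2 := finrank_range_add_ker_int δ
  have h3 := Submodule.finrank_mono hker
  have h4 := Submodule.finrank_le (LinearMap.range w)
  rw [Module.finrank_fintype_fun_eq_card, Fintype.card_coe] at h4
  have h5 : 0 < Module.finrank ℤ (LinearMap.ker δ) := by
    rw [Module.finrank_pos_iff]
    refine ⟨⟨⟨fun _ => 1, hδ⟩, 0, fun heq => ?_⟩⟩
    obtain ⟨k⟩ := (inferInstance : Nonempty κ)
    have := congrFun (congrArg Subtype.val heq) k
    simp at this
  omega

/-! ### The sheets of a branched covering over a convex set of regular values -/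

theorem eqOn_of_lifts {E B : Type*} [TopologicalSpace E] [TopologicalSpace B] {p : E → B}
    {s : Set B} (cov : IsCoveringMapOn p s) {K : Set ℂ} (hK : IsPreconnected K) {σ τ : ℂ → E}
    (hσ : ContinuousOn σ K) (hτ : ContinuousOn τ K) (hs : ∀ z ∈ K, p (σ z) ∈ s)
    (heq : ∀ z ∈ K, p (σ z) = p (τ z)) {a : ℂ} (ha : a ∈ K) (hae : σ a = τ a) : EqOn σ τ K := by
  have := isPreconnected_iff_preconnectedSpace.1 hK
  have key := cov.isCoveringMap_restrictPreimage.eq_of_comp_eq (A := K)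
    (g₁ := fun z => ⟨σ z, hs z z.2⟩)
    (g₂ := fun z => ⟨τ z, by rw [mem_preimage, ← heq z z.2]; exact hs z z.2⟩)
    ((continuousOn_iff_continuous_domRestrict.1 hσ).subtype_mk fun z => hs z z.2)
    ((continuousOn_iff_continuous_domRestrict.1 hτ).subtype_mk fun z => by
      rw [mem_preimage, domRestrict_apply, ← heq z z.2]
      exact hs z z.2)
    (by
      funext z
      exact Subtype.ext (heq z z.2)) ⟨a, ha⟩ (Subtype.ext hae)
  intro z hz
  exact congrArg Subtype.val (congrFun key ⟨z, hz⟩)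

section Sheets

variable {M N : Type*} [TopologicalSpace M] [TopologicalSpace N] {f : M → N}

/-- Over a convex open set `K` of regular values in a planar chart `φ`, a branched covering is
trivial: `σ e` is the section over `K` through the point `e` of the fibre over the base point `b`,
and `lab x` is the point of that fibre on the sheet of `x`. -/
theorem exists_sheets [T2Space M] (hf : Continuous f) {φ : OpenPartialHomeomorph N ℂ}
    (hφ : φ.target = univ) {K : Set ℂ} (hK : Convex ℝ K) (hKo : IsOpen K)
    (cov : IsCoveringMapOn f (φ.source ∩ φ ⁻¹' K)) {b : ℂ} (hb : b ∈ K)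
    (hfin : (f ⁻¹' {φ.symm b}).Finite) :
    ∃ (lab : M → M) (σ : M → ℂ → M),
      (∀ e, f e = φ.symm b → ContinuousOn (σ e) K ∧ σ e b = e ∧
        ∀ z ∈ K, f (σ e z) = φ.symm z ∧ lab (σ e z) = e) ∧
      ∀ x, f x ∈ φ.source → φ (f x) ∈ K →
        f (lab x) = φ.symm b ∧ σ (lab x) (φ (f x)) = x ∧ ∀ᶠ x' in 𝓝 x, lab x' = lab x := by
  classical
  have ht : ∀ z, z ∈ φ.target := fun z => hφ ▸ mem_univ z
  have hsymm : ContinuousOn φ.symm K := φ.continuousOn_symm.mono fun z _ => ht z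
  have hmaps : MapsTo φ.symm K (φ.source ∩ φ ⁻¹' K) := fun z hz =>
    ⟨φ.map_target (ht z), by rwa [mem_preimage, φ.right_inv (ht z)]⟩
  have hsec : ∀ x, f x ∈ φ.source → φ (f x) ∈ K → ∃ τ : ℂ → M, ContinuousOn τ K ∧
      τ (φ (f x)) = x ∧ ∀ z ∈ K, f (τ z) = φ.symm z := fun x hx hxK =>
    exists_lift_of_convex cov hK hsymm hmaps hxK (φ.left_inv hx).symm
  have hfib : ∀ e, f e = φ.symm b → f e ∈ φ.source ∧ φ (f e) = b := fun e he => by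
    rw [he]
    exact ⟨φ.map_target (ht b), φ.right_inv (ht b)⟩
  let σ : M → ℂ → M := fun e => if h : f e = φ.symm b then
    (hsec e (hfib e h).1 ((hfib e h).2.symm ▸ hb)).choose else fun _ => e
  have hσ : ∀ e, f e = φ.symm b → ContinuousOn (σ e) K ∧ σ e b = e ∧
      ∀ z ∈ K, f (σ e z) = φ.symm z := by
    intro e he
    have h := (hsec e (hfib e he).1 ((hfib e he).2.symm ▸ hb)).choose_spec
    simp only [σ, dif_pos he]
    refine ⟨h.1, ?_, h.2.2⟩
    conv_lhs => arg 2; rw [← (hfib e he).2]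
    exact h.2.1
  have hlab : ∀ x, f x ∈ φ.source → φ (f x) ∈ K →
      ∃ e, f e = φ.symm b ∧ σ e (φ (f x)) = x := by
    intro x hx hxK
    obtain ⟨τ, hτ, hτx, hτf⟩ := hsec x hx hxK
    refine ⟨τ b, hτf b hb, ?_⟩
    obtain ⟨h1, h2, h3⟩ := hσ _ (hτf b hb)
    have := eqOn_of_lifts cov hK.isPreconnected h1 hτ
      (fun z hz => by rw [h3 z hz]; exact hmaps hz)
      (fun z hz => (h3 z hz).trans (hτf z hz).symm) hb h2
    rw [this hxK, hτx]
  have huniq : ∀ e e', f e = φ.symm b → f e' = φ.symm b → ∀ z ∈ K, σ e z = σ e' z → e = e' := by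
    intro e e' he he' z hz hzz
    obtain ⟨h1, h2, h3⟩ := hσ e he
    obtain ⟨h1', h2', h3'⟩ := hσ e' he'
    have := eqOn_of_lifts cov hK.isPreconnected h1 h1'
      (fun z hz => by rw [h3 z hz]; exact hmaps hz)
      (fun z hz => (h3 z hz).trans (h3' z hz).symm) hz hzz
    rw [← h2, ← h2', this hb]
  let lab : M → M := fun x => if h : f x ∈ φ.source ∧ φ (f x) ∈ K then
    (hlab x h.1 h.2).choose else x
  have hlab' : ∀ x, f x ∈ φ.source → φ (f x) ∈ K →
      f (lab x) = φ.symm b ∧ σ (lab x) (φ (f x)) = x := by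
    intro x hx hxK
    simp only [lab, dif_pos (And.intro hx hxK)]
    exact (hlab x hx hxK).choose_spec
  refine ⟨lab, σ, fun e he => ?_, fun x hx hxK => ⟨(hlab' x hx hxK).1, (hlab' x hx hxK).2, ?_⟩⟩
  · obtain ⟨h1, h2, h3⟩ := hσ e he
    refine ⟨h1, h2, fun z hz => ⟨h3 z hz, ?_⟩⟩
    have hs : f (σ e z) ∈ φ.source ∧ φ (f (σ e z)) = z := by
      rw [h3 z hz]
      exact ⟨φ.map_target (ht z), φ.right_inv (ht z)⟩
    obtain ⟨h4, h5⟩ := hlab' (σ e z) hs.1 (by rwa [hs.2])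
    rw [hs.2] at h5
    exact huniq _ _ h4 he z hz h5
  · have hcφ : ContinuousAt (fun x => φ (f x)) x :=
      (φ.continuousAt hx).comp hf.continuousAt
    -- The sheets other than that of `x` are finitely many and closed.
    have hev : ∀ᶠ x' in 𝓝 x, ∀ e ∈ f ⁻¹' {φ.symm b}, e ≠ lab x → σ e (φ (f x')) ≠ x' := by
      refine (Filter.eventually_all_finite hfin).2 fun e he => ?_
      by_cases hne : e = lab x
      · exact Filter.Eventually.of_forall fun x' h => absurd hne h
      · have hcσ : ContinuousAt (fun x => σ e (φ (f x))) x :=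
          ((hσ e he).1.continuousAt (hKo.mem_nhds hxK)).comp (f := fun x => φ (f x)) hcφ
        have hxe : σ e (φ (f x)) ≠ x := fun h => hne
          (huniq e (lab x) he (hlab' x hx hxK).1 _ hxK (h.trans (hlab' x hx hxK).2.symm))
        have := (hcσ.prodMk continuousAt_id).eventually
          (isClosed_diagonal.isOpen_compl.mem_nhds (show (σ e (φ (f x)), id x) ∈ (diagonal M)ᶜ by
            simpa using hxe))
        filter_upwards [this] with x' hx' _ h
        exact hx' (by simpa using h)
    filter_upwards [hev, hf.continuousAt.eventually (φ.open_source.mem_nhds hx),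
      hcφ.eventually (hKo.mem_nhds hxK)] with x' h1 h2 h3
    by_contra hne
    obtain ⟨h4, h5⟩ := hlab' x' h2 h3
    exact h1 _ h4 hne h5

/-- A branched covering of a sphere by a sphere which is unramified away from one point of the
target has degree one, because the complement of that point is simply connected. -/
theorem HasTotalDegree.eq_one (hM : IsTopSphere M) (hN : IsTopSphere N) (hf : IsBranchedCover f)
    {d : ℕ} (hd : HasTotalDegree f d) (y₀ : N) (h1 : ∀ x, f x ≠ y₀ → localDegree f x = 1) :
    d = 1 := by
  have := hM.compactSpace
  have := hM.t2Space
  have := hM.connectedSpace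
  have := hN.t2Space
  obtain ⟨φ, hφs, hφt⟩ := hN.exists_plane y₀
  have hpos := hd.pos hf
  obtain ⟨q₀, hq₀⟩ := hd.surjective hpos y₀
  obtain ⟨ξ, hξs, hξt⟩ := hM.exists_plane q₀
  have hne : ∀ z, φ.symm z ≠ y₀ := fun z => by
    have : φ.symm z ∈ φ.source := φ.map_target (hφt ▸ mem_univ z)
    rwa [hφs] at this
  obtain ⟨lab, σ, hσ, hlab⟩ := exists_sheets hf.1 hφt convex_univ isOpen_univ
    (hf.isCoveringMapOn (s := φ.source ∩ φ ⁻¹' univ) fun x hx => h1 x (by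
      have := hx.1
      rwa [hφs] at this)) (mem_univ (0 : ℂ)) (hf.finite_fiber _)
  have hconn : IsPreconnected (f ⁻¹' {y₀})ᶜ := by
    have hfinQ : (ξ '' (f ⁻¹' {y₀} \ {q₀})).Finite := ((hf.finite_fiber y₀).sdiff).image _
    have hrank : 1 < Module.rank ℝ ℂ := by
      rw [← Module.finrank_eq_rank]
      simp
    have hc := (hfinQ.countable.isPathConnected_compl_of_one_lt_rank hrank).isConnected.isPreconnected
    have himg : (f ⁻¹' {y₀})ᶜ = ξ.symm '' (ξ '' (f ⁻¹' {y₀} \ {q₀}))ᶜ := by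
      ext x
      constructor
      · intro hx
        have hxs : x ∈ ξ.source := by
          rw [hξs]
          rintro rfl
          exact hx hq₀
        refine ⟨ξ x, ?_, ξ.left_inv hxs⟩
        rintro ⟨x', hx', hxx'⟩
        have hx's : x' ∈ ξ.source := by
          rw [hξs]
          exact hx'.2
        rw [ξ.injOn hx's hxs hxx'] at hx'
        exact hx hx'.1
      · rintro ⟨z, hz, rfl⟩ hx
        have hzt : z ∈ ξ.target := hξt ▸ mem_univ z
        refine hz ⟨_, ⟨hx, ?_⟩, ξ.right_inv hzt⟩
        have := ξ.map_target hzt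
        rwa [hξs] at this
    rw [himg]
    exact hc.image _ (ξ.continuousOn_symm.mono fun z _ => hξt ▸ mem_univ z)
  have hlc : ∀ x ∈ (f ⁻¹' {y₀})ᶜ, ∀ x' ∈ (f ⁻¹' {y₀})ᶜ, lab x = lab x' := by
    intro x hx x' hx'
    refine hconn.induction₂ (fun x x' => lab x = lab x') (fun x hx => ?_)
      (fun _ _ _ _ _ _ => Eq.trans) (fun _ _ _ _ => Eq.symm) hx hx'
    refine Filter.Eventually.filter_mono nhdsWithin_le_nhds ?_
    exact (hlab x (by rw [hφs]; exact hx) trivial).2.2.mono fun _ h => h.symm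
  have hfib : (f ⁻¹' {φ.symm 0}).Subsingleton := by
    intro e he e' he'
    have hl : ∀ e, f e = φ.symm 0 → lab e = e ∧ e ∈ (f ⁻¹' {y₀})ᶜ := fun e he => by
      obtain ⟨-, h2, h3⟩ := hσ e he
      have := (h3 0 trivial).2
      rw [h2] at this
      exact ⟨this, fun h => hne 0 (he.symm.trans h)⟩
    rw [← (hl e he).1, ← (hl e' he').1]
    exact hlc _ (hl e he).2 _ (hl e' he').2
  have hcard := hd.ncard_fiber (y := φ.symm 0) fun x hx => h1 x (hx ▸ hne 0)
  have : Finite ↑(f ⁻¹' {φ.symm 0}) := hf.finite_fiber _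
  have := ncard_le_one_iff_subsingleton.2 hfib
  omega

end Sheets

/-! ### The Riemann–Hurwitz inequality for branched coverings between spheres -/

/-- A finite set of points of the plane can be sorted by a linear functional. -/
theorem exists_strictMono_functional {A : Set ℂ} {n : ℕ} (hA : A.Finite) (hn : A.ncard = n) :
    ∃ (L : ℂ →ₗ[ℝ] ℝ) (p : Fin n → ℂ), StrictMono (fun i => L (p i)) ∧ range p = A := by
  classical
  lift A to Finset ℂ using hA
  rw [ncard_coe_finset] at hn
  obtain ⟨L, hL⟩ := Module.exists_dual_forall_apply_ne_zero (K := ℝ)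
    (fun q : {q : A × A // q.1 ≠ q.2} => (q.1.1 : ℂ) - q.1.2)
    fun q => sub_ne_zero.2 fun h => q.2 (Subtype.ext h)
  have hinj : InjOn L A := by
    intro a ha b hb hab
    by_contra hne
    refine hL ⟨(⟨a, ha⟩, ⟨b, hb⟩), fun h => hne (congrArg Subtype.val h)⟩ ?_
    rw [map_sub, hab, sub_self]
  have hcard : (A.image L).card = n := by rw [Finset.card_image_of_injOn hinj, hn]
  let e := (A.image L).orderEmbOfFin hcard
  have he : ∀ i, ∃ a ∈ A, L a = e i := fun i =>
    Finset.mem_image.1 (Finset.orderEmbOfFin_mem _ hcard i)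
  choose p hpA hpe using he
  refine ⟨L, p, fun i j hij => ?_, ?_⟩
  · simp only [hpe]
    exact e.strictMono hij
  · ext a
    refine ⟨by rintro ⟨i, rfl⟩; exact hpA i, fun ha => ?_⟩
    have : L a ∈ range e := by
      rw [Finset.range_orderEmbOfFin]
      exact Finset.mem_coe.2 (Finset.mem_image_of_mem L ha)
    obtain ⟨i, hi⟩ := this
    exact ⟨i, hinj (hpA i) ha (by rw [hpe, hi])⟩

/-- A circle-valued function that turns `ℓ` times while the real function `s` crosses the
interval `(a, b)`, where the integer `ℓ` may vary from one sheet to another, and is trivial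
elsewhere, is continuous. -/
theorem continuousAt_turn {M : Type*} [TopologicalSpace M] {s : M → ℝ} {x : M}
    (hs : ContinuousAt s x) {a b : ℝ} (hab : a < b) {ℓ : M → ℤ} {B : ℝ} (hB : ∀ x, |(ℓ x : ℝ)| ≤ B)
    (hloc : s x ∈ Ioo a b → ∀ᶠ x' in 𝓝 x, ℓ x' = ℓ x) :
    ContinuousAt (fun x' => if s x' ∈ Ioo a b then
      ((ℓ x' * ((s x' - a) / (b - a)) : ℝ) : AddCircle (1 : ℝ)) else 0) x := by
  have hcoe : Continuous ((↑) : ℝ → AddCircle (1 : ℝ)) := AddCircle.continuous_mk' 1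
  have hba : 0 < b - a := sub_pos.2 hab
  have hT : ContinuousAt (fun x' => (s x' - a) / (b - a)) x := (hs.sub continuousAt_const).div_const _
  by_cases hx : s x ∈ Ioo a b
  · have hc : ContinuousAt (fun x' => ((ℓ x * ((s x' - a) / (b - a)) : ℝ) : AddCircle (1 : ℝ))) x :=
      hcoe.continuousAt.comp (f := fun x' => (ℓ x * ((s x' - a) / (b - a)) : ℝ))
        (continuousAt_const.mul hT)
    refine hc.congr ?_
    filter_upwards [hloc hx, hs.eventually (isOpen_Ioo.mem_nhds hx)] with x' h1 h2
    rw [if_pos (show s x' ∈ Ioo a b from h2), h1]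
  by_cases hend : s x = a ∨ s x = b
  · -- At an end of the interval the function is, modulo integers, a bounded multiple of a function
    -- tending to zero.
    obtain ⟨τ, hτ⟩ : ∃ τ : ℤ, (s x - a) / (b - a) = τ := by
      rcases hend with h | h
      · exact ⟨0, by simp [h]⟩
      · exact ⟨1, by rw [h, div_self hba.ne', Int.cast_one]⟩
    let y : M → ℝ := fun x' => if s x' ∈ Ioo a b then ℓ x' * ((s x' - a) / (b - a) - τ) else 0
    have hyx : y x = 0 := if_neg hx
    have hy : ContinuousAt y x := by
      rw [ContinuousAt, hyx]
      have hlim : Filter.Tendsto (fun x' => B * |(s x' - a) / (b - a) - τ|) (𝓝 x) (𝓝 0) := by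
        have := ((hT.tendsto.sub_const (τ : ℝ)).abs).const_mul B
        simpa only [hτ, sub_self, abs_zero, mul_zero] using this
      refine squeeze_zero_norm (fun x' => ?_) hlim
      simp only [y]
      split_ifs
      · rw [Real.norm_eq_abs, abs_mul]
        exact mul_le_mul_of_nonneg_right (hB x') (abs_nonneg _)
      · rw [norm_zero]
        exact mul_nonneg ((abs_nonneg _).trans (hB x')) (abs_nonneg _)
    refine (hcoe.continuousAt.comp hy).congr (Filter.Eventually.of_forall fun x' => ?_)
    simp only [Function.comp, y]
    split_ifs
    · rw [← sub_eq_zero, ← AddCircle.coe_sub, coe_eq_zero_iff_exists_int]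
      exact ⟨-(ℓ x' * τ), by push_cast; ring⟩
    · exact AddCircle.coe_zero 1
  · have hIcc : s x ∉ Icc a b := fun h => hend (by
      by_contra hcon
      push Not at hcon
      exact hx ⟨lt_of_le_of_ne h.1 hcon.1.symm, lt_of_le_of_ne h.2 hcon.2⟩)
    refine (continuousAt_const (y := (0 : AddCircle (1 : ℝ)))).congr ?_
    filter_upwards [hs.eventually (isClosed_Icc.isOpen_compl.mem_nhds hIcc)] with x' h
    rw [if_neg fun h' => h (Ioo_subset_Icc_self h')]

section

variable {M N : Type*} [TopologicalSpace M] [TopologicalSpace N] {f : M → N}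

theorem exists_mem_closure_sheet [CompactSpace M] [T2Space N] (hf : Continuous f)
    {φ : OpenPartialHomeomorph N ℂ} (hφ : φ.target = univ) {K : Set ℂ} {σ : ℂ → M}
    (hσ : ∀ z ∈ K, f (σ z) = φ.symm z) {p : ℂ} (hp : p ∈ closure K) :
    ∃ l ∈ closure (σ '' K), f l = φ.symm p := by
  have hcl : IsClosed (f '' closure (σ '' K)) := hf.isClosedMap _ isClosed_closure
  have hsub : φ.symm '' K ⊆ f '' closure (σ '' K) := by
    rintro _ ⟨z, hz, rfl⟩
    exact ⟨σ z, subset_closure ⟨z, hz, rfl⟩, hσ z hz⟩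
  have hcont : Continuous φ.symm := by
    rw [← continuousOn_univ, ← hφ]
    exact φ.continuousOn_symm
  have : φ.symm p ∈ closure (φ.symm '' K) := image_closure_subset_closure_image hcont ⟨p, hp, rfl⟩
  exact closure_minimal hsub hcl this

theorem eq_of_mem_closure {F : M → ℝ} {S : Set M} {l : M} {u : ℝ} (hF : ContinuousAt F l)
    (hl : l ∈ closure S) (hu : ∀ x ∈ S, F x = u) : F l = u := by
  have : (𝓝[S] l).NeBot := mem_closure_iff_nhdsWithin_neBot.1 hl
  refine tendsto_nhds_unique (hF.tendsto.mono_left (nhdsWithin_le_nhds (s := S))) ?_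
  refine tendsto_const_nhds.congr' ?_
  filter_upwards [self_mem_nhdsWithin] with x hx
  exact (hu x hx).symm

/-- The Riemann–Hurwitz inequality: if `f` is a degree `d` branched covering between spheres,
unramified over the complement of the finite set `P`, then
`d * (2 - |P|) ≥ 2 - |f ⁻¹ P|`. It expresses that the source has genus zero. -/
theorem riemannHurwitz_le (hM : IsTopSphere M) (hN : IsTopSphere N) (hf : IsBranchedCover f)
    {d : ℕ} (hd : HasTotalDegree f d) {P : Set N} (hP : P.Finite) (hP2 : 2 ≤ P.ncard)
    (hcrit : ∀ x, f x ∉ P → localDegree f x = 1) :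
    P.ncard * d + 2 ≤ (f ⁻¹' P).ncard + 2 * d := by
  classical
  have := hM.compactSpace
  have := hM.t2Space
  have := hM.connectedSpace
  have := hN.t2Space
  obtain ⟨p₀, hp₀⟩ : P.Nonempty := nonempty_of_ncard_ne_zero (by omega)
  obtain ⟨φ, hφs, hφt⟩ := hN.exists_plane p₀
  have ht : ∀ z, z ∈ φ.target := fun z => hφt ▸ mem_univ z
  have hne : ∀ z, φ.symm z ≠ p₀ := fun z => by
    have := φ.map_target (ht z)
    rwa [hφs] at this
  have hsrc : ∀ {y}, y ≠ p₀ → y ∈ φ.source := fun {y} hy => by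
    rw [hφs]
    exact hy
  have hpos := hd.pos hf
  obtain ⟨q₀, hq₀⟩ := hd.surjective hpos p₀
  obtain ⟨ξ, hξs, hξt⟩ := hM.exists_plane q₀
  have hξt' : ∀ z, z ∈ ξ.target := fun z => hξt ▸ mem_univ z
  -- The finite branch points, sorted by a linear functional.
  obtain ⟨n, hn⟩ : ∃ n, P.ncard = n + 2 := ⟨P.ncard - 2, by omega⟩
  have hP' : (P \ {p₀}).ncard = n + 1 := by
    rw [ncard_sdiff_singleton_of_mem hp₀]
    omega
  have hPs : P \ {p₀} ⊆ φ.source := fun y hy => hsrc hy.2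
  obtain ⟨L, p, hLp, hrange⟩ := exists_strictMono_functional (A := φ '' (P \ {p₀})) (n := n + 1)
    (hP.sdiff.image _) (by rw [(φ.injOn.mono hPs).ncard_image, hP'])
  have hL : Continuous L := L.continuous_of_finiteDimensional
  have hpP : ∀ i, φ.symm (p i) ∈ P \ {p₀} := fun i => by
    obtain ⟨y, hy, hyi⟩ := (hrange ▸ mem_range_self i : p i ∈ φ '' (P \ {p₀}))
    rwa [← hyi, φ.left_inv (hPs hy)]
  -- The strips between consecutive branch points.
  let K : Fin n → Set ℂ := fun k => L ⁻¹' Ioo (L (p k.castSucc)) (L (p k.succ))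
  have hlt : ∀ k : Fin n, L (p k.castSucc) < L (p k.succ) := fun k => hLp k.castSucc_lt_succ
  have hKo : ∀ k, IsOpen (K k) := fun k => isOpen_Ioo.preimage hL
  have hKc : ∀ k, Convex ℝ (K k) := fun k => (convex_Ioo _ _).linear_preimage L
  have hpK : ∀ i k, p i ∉ K k := by
    rintro i k ⟨h1, h2⟩
    have h1 := hLp.lt_iff_lt.1 h1
    have h2 := hLp.lt_iff_lt.1 h2
    rw [Fin.lt_def] at h1 h2
    simp at h1 h2
    omega
  have hKdisj : ∀ k j z, z ∈ K k → z ∈ K j → k = j := by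
    have key : ∀ k j z, k < j → z ∈ K k → z ∈ K j → False := by
      rintro k j z hkj ⟨-, h1⟩ ⟨h2, -⟩
      have : L (p k.succ) ≤ L (p j.castSucc) := hLp.monotone (by
        rw [Fin.le_def]
        simpa using hkj)
      linarith
    intro k j z h1 h2
    rcases lt_trichotomy k j with h | h | h
    · exact (key k j z h h1 h2).elim
    · exact h
    · exact (key j k z h h2 h1).elim
  let T : Fin n → ℂ → ℝ := fun k z =>
    (L z - L (p k.castSucc)) / (L (p k.succ) - L (p k.castSucc))
  have hseg : ∀ (k : Fin n) (t : ℝ), L (p k.castSucc + t • (p k.succ - p k.castSucc)) =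
      L (p k.castSucc) + t * (L (p k.succ) - L (p k.castSucc)) := fun k t => by
    rw [map_add, map_smul, map_sub, smul_eq_mul]
  have hsegK : ∀ (k : Fin n) (t : ℝ), t ∈ Ioo (0 : ℝ) 1 →
      p k.castSucc + t • (p k.succ - p k.castSucc) ∈ K k := by
    rintro k t ⟨h0, h1⟩
    have := hlt k
    constructor
    · rw [hseg]
      nlinarith
    · rw [hseg]
      nlinarith
  have hclos : ∀ (k : Fin n) (t : ℝ), t ∈ Icc (0 : ℝ) 1 →
      p k.castSucc + t • (p k.succ - p k.castSucc) ∈ closure (K k) := by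
    intro k t hts
    rw [← closure_Ioo (zero_ne_one' ℝ)] at hts
    have hc : Continuous fun t : ℝ => p k.castSucc + t • (p k.succ - p k.castSucc) := by fun_prop
    refine closure_mono ?_ (image_closure_subset_closure_image hc ⟨t, hts, rfl⟩)
    rintro _ ⟨t, ht, rfl⟩
    exact hsegK k t ht
  let b : Fin n → ℂ := fun k => p k.castSucc + (1 / 2 : ℝ) • (p k.succ - p k.castSucc)
  have hbK : ∀ k, b k ∈ K k := fun k => hsegK k _ (by norm_num)
  have hKP : ∀ k, ∀ z ∈ K k, φ.symm z ∉ P := by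
    intro k z hz hzP
    have : φ (φ.symm z) ∈ range p := hrange ▸ mem_image_of_mem φ ⟨hzP, hne z⟩
    rw [φ.right_inv (ht z)] at this
    obtain ⟨i, rfl⟩ := this
    exact hpK i k hz
  choose lab σ hσ hlab using fun k => exists_sheets hf.1 hφt (hKc k) (hKo k)
    (hf.isCoveringMapOn (s := φ.source ∩ φ ⁻¹' K k) fun x hx => hcrit x fun hxP =>
      hKP k _ hx.2 (by rwa [φ.left_inv hx.1])) (hbK k) (hf.finite_fiber _)
  -- The edges of the graph: the sheets over the strips.
  let ι : Type _ := Σ k : Fin n, f ⁻¹' {φ.symm (b k)}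
  have hfinι : ∀ k, Finite (f ⁻¹' {φ.symm (b k)}) := fun k => hf.finite_fiber _
  have hι : Nat.card ι = n * d := by
    have := fun k => Fintype.ofFinite (f ⁻¹' {φ.symm (b k)})
    rw [Nat.card_sigma]
    have hk : ∀ k : Fin n, Nat.card (f ⁻¹' {φ.symm (b k)}) = d := fun k =>
      hd.ncard_fiber fun x hx => hcrit x (hx ▸ hKP k _ (hbK k))
    simp only [hk, Finset.sum_const, Finset.card_univ, Fintype.card_fin, smul_eq_mul]
  -- The vertices of the graph: the preimages of the finite branch points.
  let κ : Type _ := f ⁻¹' (P \ {p₀})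
  have hfinκ : (f ⁻¹' (P \ {p₀})).Finite := hP.sdiff.preimage' fun y _ => hf.finite_fiber y
  have : Finite κ := hfinκ
  have : Nonempty κ := by
    obtain ⟨x, hx⟩ := hd.surjective hpos (φ.symm (p 0))
    exact ⟨⟨x, by rw [mem_preimage, hx]; exact hpP 0⟩⟩
  have hl : ∀ i : ι, ∃ l ∈ closure (σ i.1 i.2 '' K i.1), f l = φ.symm (p i.1.castSucc) := fun i => by
    refine exists_mem_closure_sheet hf.1 hφt (fun z hz => (((hσ i.1 i.2 i.2.2).2.2) z hz).1) ?_
    simpa using hclos i.1 0 (by norm_num)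
  have hr : ∀ i : ι, ∃ l ∈ closure (σ i.1 i.2 '' K i.1), f l = φ.symm (p i.1.succ) := fun i => by
    refine exists_mem_closure_sheet hf.1 hφt (fun z hz => (((hσ i.1 i.2 i.2.2).2.2) z hz).1) ?_
    simpa using hclos i.1 1 (by norm_num)
  choose l hlc hlf using hl
  choose r hrc hrf using hr
  let l' : ι → κ := fun i => ⟨l i, by rw [mem_preimage, hlf]; exact hpP _⟩
  let r' : ι → κ := fun i => ⟨r i, by rw [mem_preimage, hrf]; exact hpP _⟩
  let δ : (κ → ℤ) →ₗ[ℤ] (ι → ℤ) := LinearMap.funLeft ℤ ℤ r' - LinearMap.funLeft ℤ ℤ l'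
  -- The circle-valued map which turns `c i` times across the sheet `i`.
  let c' : (ι → ℤ) → Fin n → M → ℤ := fun c k e =>
    if h : f e = φ.symm (b k) then c ⟨k, ⟨e, h⟩⟩ else 0
  have hc'add : ∀ c₁ c₂ k e, c' (c₁ + c₂) k e = c' c₁ k e + c' c₂ k e := by
    intro c₁ c₂ k e
    simp only [c']
    split_ifs <;> simp
  have hc'B : ∀ c k e, |(c' c k e : ℝ)| ≤ ∑ᶠ i, |(c i : ℝ)| := by
    intro c k e
    have := Fintype.ofFinite ι
    rw [finsum_eq_sum_of_fintype]
    simp only [c']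
    split_ifs with h
    · exact Finset.single_le_sum (f := fun i => |(c i : ℝ)|) (fun _ _ => abs_nonneg _)
        (Finset.mem_univ _)
    · simpa using Finset.sum_nonneg fun i _ => abs_nonneg (c i : ℝ)
  let s : M → ℝ := fun x => L (φ (f x))
  have hs : ∀ x, f x ≠ p₀ → ContinuousAt s x := fun x hx =>
    hL.continuousAt.comp ((φ.continuousAt (hsrc hx)).comp hf.1.continuousAt)
  let h : (ι → ℤ) → M → AddCircle (1 : ℝ) := fun c x => ∑ k : Fin n,
    if s x ∈ Ioo (L (p k.castSucc)) (L (p k.succ)) then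
      ((c' c k (lab k x) * ((s x - L (p k.castSucc)) / (L (p k.succ) - L (p k.castSucc))) : ℝ) :
        AddCircle (1 : ℝ)) else 0
  have hhc : ∀ c x, f x ≠ p₀ → ContinuousAt (h c) x := by
    intro c x hx
    refine tendsto_finsetSum _ fun k _ => ?_
    refine continuousAt_turn (hs x hx) (hlt k) (fun x => hc'B c k (lab k x)) fun hxk => ?_
    filter_upwards [(hlab k x (hsrc hx) hxk).2.2] with x' hx'
    rw [hx']
  have hhadd : ∀ c₁ c₂ x, h (c₁ + c₂) x = h c₁ x + h c₂ x := by
    intro c₁ c₂ x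
    simp only [h, ← Finset.sum_add_distrib]
    refine Finset.sum_congr rfl fun k _ => ?_
    split_ifs
    · rw [hc'add, ← AddCircle.coe_add]
      congr 1
      push_cast
      ring
    · simp
  have hhP : ∀ c x, f x ∈ P \ {p₀} → h c x = 0 := by
    intro c x hx
    refine Finset.sum_eq_zero fun k _ => if_neg fun hk => ?_
    have : φ (f x) ∈ range p := hrange ▸ mem_image_of_mem φ hx
    obtain ⟨i, hi⟩ := this
    exact hpK i k (by rw [hi]; exact hk)
  have hhK : ∀ c k x, φ (f x) ∈ K k → h c x = ((c' c k (lab k x) * T k (φ (f x)) : ℝ) :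
      AddCircle (1 : ℝ)) := by
    intro c k x hx
    simp only [h]
    rw [Finset.sum_eq_single k, if_pos (show s x ∈ Ioo _ _ from hx)]
    · intro j _ hj
      exact if_neg fun h => hj (hKdisj j k _ h hx)
    · simp
  -- The punctures.
  have hQfin : (ξ '' (f ⁻¹' {p₀} \ {q₀})).Finite := ((hf.finite_fiber p₀).sdiff).image _
  have hQs : f ⁻¹' {p₀} \ {q₀} ⊆ ξ.source := fun x hx => by
    rw [hξs]
    exact hx.2
  have hQcard : hQfin.toFinset.card + 1 = (f ⁻¹' {p₀}).ncard := by
    rw [← ncard_eq_toFinset_card _ hQfin, (ξ.injOn.mono hQs).ncard_image]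
    exact ncard_sdiff_singleton_add_one hq₀ (hf.finite_fiber p₀)
  have hQ1 : ∀ z, z ∈ (hQfin.toFinset : Set ℂ)ᶜ → f (ξ.symm z) ≠ p₀ := by
    intro z hz hfz
    refine hz ?_
    rw [Finite.coe_toFinset]
    refine ⟨ξ.symm z, ⟨hfz, ?_⟩, ξ.right_inv (hξt' z)⟩
    have := ξ.map_target (hξt' z)
    rwa [hξs] at this
  have hQ2 : ∀ x, f x ≠ p₀ → x ∈ ξ.source ∧ ξ x ∈ (hQfin.toFinset : Set ℂ)ᶜ := by
    intro x hx
    have hxs : x ∈ ξ.source := by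
      rw [hξs]
      rintro rfl
      exact hx hq₀
    refine ⟨hxs, ?_⟩
    rw [Finite.coe_toFinset]
    rintro ⟨x', hx', hxx'⟩
    rw [ξ.injOn (hQs hx') hxs hxx'] at hx'
    exact hx hx'.1
  have hQopen : IsOpen (hQfin.toFinset : Set ℂ)ᶜ := (Finset.finite_toSet _).isClosed.isOpen_compl
  have main := card_add_one_le_of_log (ι := ι) (κ := κ) hQfin.toFinset
    (fun c z => h c (ξ.symm z)) (fun c₁ c₂ => funext fun z => hhadd c₁ c₂ _)
    (fun c z hz => ((hhc c _ (hQ1 z hz)).comp (f := ξ.symm)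
      (ξ.continuousAt_symm (hξt' z))).continuousWithinAt)
    δ (by ext i; simp [δ, LinearMap.funLeft]) (by
      rintro c ⟨H, hH, hHlog⟩
      let G : M → ℝ := fun x => H (ξ x)
      have hG : ∀ x, f x ≠ p₀ → ContinuousAt G x := fun x hx =>
        (hH.continuousAt (hQopen.mem_nhds (hQ2 x hx).2)).comp (f := ξ)
          (ξ.continuousAt (hQ2 x hx).1)
      have hGlog : ∀ x, f x ≠ p₀ → (G x : AddCircle (1 : ℝ)) = h c x := fun x hx => by
        rw [hHlog _ (hQ2 x hx).2, ξ.left_inv (hQ2 x hx).1]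
      have hGint : ∀ x : κ, ∃ m : ℤ, G x = m := fun x => by
        rw [← coe_eq_zero_iff_exists_int, hGlog _ x.2.2, hhP c _ x.2]
      choose u hu using hGint
      refine ⟨u, ?_⟩
      funext i
      obtain ⟨k, e⟩ := i
      obtain ⟨hσc, -, hσf⟩ := hσ k e e.2
      -- On a sheet, the logarithm minus the turning function is constant.
      let F : M → ℝ := fun x => G x - c ⟨k, e⟩ * T k (φ (f x))
      have hTcont : ∀ x, f x ≠ p₀ → ContinuousAt (fun x => T k (φ (f x))) x := fun x hx =>
        ((hs x hx).sub continuousAt_const).div_const _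
      have hFc : ∀ x, f x ≠ p₀ → ContinuousAt F x := fun x hx =>
        (hG x hx).sub (continuousAt_const.mul (hTcont x hx))
      have hσne : ∀ z ∈ K k, f (σ k e z) ≠ p₀ := fun z hz => by
        rw [(hσf z hz).1]
        exact hne z
      have hφσ : ∀ z ∈ K k, φ (f (σ k e z)) = z := fun z hz => by
        rw [(hσf z hz).1, φ.right_inv (ht z)]
      have hFint : ∀ x ∈ σ k e '' K k, ((F x : ℝ) : AddCircle (1 : ℝ)) = 0 := by
        rintro _ ⟨z, hz, rfl⟩
        simp only [F]
        rw [AddCircle.coe_sub, hGlog _ (hσne z hz), hhK c k _ (by rwa [hφσ z hz]), (hσf z hz).2]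
        have : c' c k e = c ⟨k, e⟩ := dif_pos e.2
        rw [this, sub_self]
      have hconst : ∀ x ∈ σ k e '' K k, F x = F (σ k e (b k)) := fun x hx =>
        eqOn_of_int_valued ((hKc k).isPreconnected.image _ hσc) (fun x hx => by
          obtain ⟨z, hz, rfl⟩ := hx
          exact (hFc _ (hσne z hz)).continuousWithinAt) hFint hx ⟨b k, hbK k, rfl⟩
      have hFl := eq_of_mem_closure (hFc _ (by rw [hlf]; exact hne _)) (hlc ⟨k, e⟩) hconst
      have hFr := eq_of_mem_closure (hFc _ (by rw [hrf]; exact hne _)) (hrc ⟨k, e⟩) hconst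
      have hTl : T k (φ (f (l ⟨k, e⟩))) = 0 := by
        rw [hlf, φ.right_inv (ht _)]
        simp [T]
      have hTr : T k (φ (f (r ⟨k, e⟩))) = 1 := by
        rw [hrf, φ.right_inv (ht _)]
        exact div_self (sub_pos.2 (hlt k)).ne'
      simp only [F, hTl] at hFl
      simp only [F, hTr] at hFr
      have hul := hu (l' ⟨k, e⟩)
      have hur := hu (r' ⟨k, e⟩)
      have : ((u (r' ⟨k, e⟩) - u (l' ⟨k, e⟩) : ℤ) : ℝ) = c ⟨k, e⟩ := by
        push_cast
        rw [← hul, ← hur]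
        simp only [l', r']
        linarith
      exact_mod_cast this)
  have hsplit : (f ⁻¹' P).ncard = Nat.card κ + (f ⁻¹' {p₀}).ncard := by
    rw [Nat.card_coe_set_eq, ← ncard_union_eq _ hfinκ (hf.finite_fiber p₀), ← preimage_union,
      sdiff_union_of_subset (singleton_subset_iff.2 hp₀)]
    exact Disjoint.preimage f disjoint_sdiff_left
  rw [hι] at main
  rw [hn, hsplit, ← hQcard, add_mul]
  omega

end

/-! ### Branches of a tree -/

namespace CombTree

variable {V : Type*} {T : CombTree V} {v a b x y : V}

/-- The branch at `v` containing `a`: the connected component of `a` in `T - {v}`. -/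
def branch (T : CombTree V) (v a : V) : Set V := {x | T.SameBranch v a x}

theorem SameBranch.symm (h : T.SameBranch v a b) : T.SameBranch v b a := by
  obtain ⟨p, hp⟩ := h
  exact ⟨p.reverse, by simpa using hp⟩

theorem SameBranch.trans (h : T.SameBranch v a b) (h' : T.SameBranch v b x) :
    T.SameBranch v a x := by
  obtain ⟨p, hp⟩ := h
  obtain ⟨q, hq⟩ := h'
  refine ⟨p.append q, ?_⟩
  rw [SimpleGraph.Walk.mem_support_append_iff]
  exact not_or.2 ⟨hp, hq⟩

theorem SameBranch.ne_right (h : T.SameBranch v a b) : b ≠ v := by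
  obtain ⟨p, hp⟩ := h
  rintro rfl
  exact hp p.end_mem_support

theorem sameBranch_self (h : a ≠ v) : T.SameBranch v a a :=
  ⟨SimpleGraph.Walk.nil, by simpa using h.symm⟩

theorem mem_verts_left (h : T.graph.Adj v a) : v ∈ T.verts := T.mem_of_adj _ _ h

theorem mem_verts_right (h : T.graph.Adj v a) : a ∈ T.verts := T.mem_of_adj _ _ h.symm

theorem mem_verts_of_walk (p : T.graph.Walk a b) (ha : a ∈ T.verts) : b ∈ T.verts := by
  induction p with
  | nil => exact ha
  | cons h _ ih => exact ih (mem_verts_right h)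

theorem self_mem_branch (h : T.graph.Adj v a) : a ∈ T.branch v a :=
  sameBranch_self h.ne'

theorem branch_subset_verts (h : T.graph.Adj v a) : T.branch v a ⊆ T.verts := by
  rintro x ⟨p, -⟩
  exact mem_verts_of_walk p (mem_verts_right h)

theorem not_mem_branch_self : v ∉ T.branch v a := fun h => SameBranch.ne_right h rfl

theorem exists_mem_branch (hv : v ∈ T.verts) (hx : x ∈ T.verts) (hxv : x ≠ v) :
    ∃ a, T.graph.Adj v a ∧ x ∈ T.branch v a := by
  classical
  obtain ⟨p⟩ := T.connected v hv x hx
  have hp := p.bypass_isPath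
  cases hq : p.bypass with
  | nil => exact (hxv rfl).elim
  | cons h q =>
    rw [hq, SimpleGraph.Walk.cons_isPath_iff] at hp
    exact ⟨_, h, q, hp.2⟩

theorem eq_of_sameBranch (ha : T.graph.Adj v a) (hb : T.graph.Adj v b) (h : T.SameBranch v a b) :
    a = b := by
  classical
  obtain ⟨p, hp⟩ := h
  have hv : v ∉ p.bypass.support := fun h => hp (p.support_bypass_subset_support h)
  have h1 : (SimpleGraph.Walk.cons ha p.bypass).IsPath :=
    (SimpleGraph.Walk.cons_isPath_iff _ _).2 ⟨p.bypass_isPath, hv⟩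
  have h2 : (SimpleGraph.Walk.cons hb SimpleGraph.Walk.nil).IsPath := by
    simpa using hb.ne
  have := congrArg (fun q : T.graph.Path v b => q.1.snd)
    ((T.acyclic.subsingleton_path v b).elim ⟨_, h1⟩ ⟨_, h2⟩)
  simpa using this

theorem mem_branch_iff (h : T.graph.Adj v a) :
    x ∈ T.branch v a ↔ x = a ∨ ∃ b, T.graph.Adj a b ∧ b ≠ v ∧ x ∈ T.branch a b := by
  classical
  constructor
  · rintro ⟨p, hp⟩
    have hpath := p.bypass_isPath
    have hv : v ∉ p.bypass.support := fun h => hp (p.support_bypass_subset_support h)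
    cases hq : p.bypass with
    | nil => exact Or.inl rfl
    | cons h q =>
      rw [hq] at hpath hv
      rw [SimpleGraph.Walk.cons_isPath_iff] at hpath
      refine Or.inr ⟨_, h, ?_, q, hpath.2⟩
      rintro rfl
      exact hv (by simp)
  · rintro (rfl | ⟨b, hab, hbv, p, hp⟩)
    · exact self_mem_branch h
    · refine ⟨SimpleGraph.Walk.cons hab p, ?_⟩
      rw [SimpleGraph.Walk.support_cons, List.mem_cons, not_or]
      refine ⟨h.ne, fun hv => hbv ?_⟩
      exact eq_of_sameBranch hab h.symm
        ⟨p.takeUntil v hv, fun ha => hp (p.support_takeUntil_subset_support hv ha)⟩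

/-- Induction on the size of the branch that a directed edge points into. -/
theorem branch_induction {P : V → V → Prop}
    (ih : ∀ v a, T.graph.Adj v a → (∀ b, T.graph.Adj a b → b ≠ v → P a b) → P v a) :
    ∀ v a, T.graph.Adj v a → P v a := by
  suffices ∀ n v a, T.graph.Adj v a → (T.branch v a).ncard = n → P v a from
    fun v a h => this _ v a h rfl
  intro n
  induction n using Nat.strong_induction_on with
  | _ n IH =>
    rintro v a h rfl
    refine ih v a h fun b hab hbv => IH _ ?_ a b hab rfl
    refine ncard_lt_ncard ⟨fun x hx => (mem_branch_iff h).2 (Or.inr ⟨b, hab, hbv, hx⟩),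
      fun hsub => ?_⟩ (T.finite_verts.subset (branch_subset_verts h))
    exact not_mem_branch_self (hsub (self_mem_branch h))

theorem finite_neighborSet (T : CombTree V) (v : V) : (T.graph.neighborSet v).Finite :=
  T.finite_verts.subset fun _ h => mem_verts_right h

theorem eq_of_leaf (hv : v ∈ T.leaves) (ha : T.graph.Adj v a) (hb : T.graph.Adj v b) : a = b := by
  obtain ⟨c, hc⟩ := ncard_eq_one.1 hv.2
  have h1 : a ∈ T.graph.neighborSet v := ha
  have h2 : b ∈ T.graph.neighborSet v := hb
  rw [hc] at h1 h2
  exact h1.trans h2.symm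

theorem branch_leaf (h : T.graph.Adj v a) (ha : a ∈ T.leaves) : T.branch v a = {a} := by
  ext x
  rw [mem_branch_iff h, mem_singleton_iff]
  refine ⟨?_, Or.inl⟩
  rintro (hx | ⟨b, hab, hbv, -⟩)
  · exact hx
  · exact (hbv (eq_of_leaf ha hab h.symm)).elim

theorem exists_leaf_mem_branch : ∀ v a, T.graph.Adj v a → ∃ x ∈ T.leaves, x ∈ T.branch v a := by
  refine branch_induction fun v a h ih => ?_
  by_cases ha : T.valence a = 1
  · exact ⟨a, ⟨mem_verts_right h, ha⟩, self_mem_branch h⟩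
  · obtain ⟨b, hab, hbv⟩ : ∃ b, T.graph.Adj a b ∧ b ≠ v := by
      by_contra hcon
      push Not at hcon
      refine ha (ncard_eq_one.2 ⟨v, ?_⟩)
      ext b
      exact ⟨hcon b, by rintro rfl; exact h.symm⟩
    obtain ⟨x, hx, hxb⟩ := ih b hab hbv
    exact ⟨x, hx, (mem_branch_iff h).2 (Or.inr ⟨b, hab, hbv, hxb⟩)⟩

/-- Two branches which meet, neither of which contains the root of the other, are equal. -/
theorem branch_eq_of_meet {v' a' : V} (h : T.graph.Adj v a) (h' : T.graph.Adj v' a')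
    (hy : y ∈ T.branch v a) (hy' : y ∈ T.branch v' a') (hv' : v' ∉ T.branch v a)
    (hv : v ∉ T.branch v' a') : v = v' ∧ a = a' := by
  classical
  have hvv : v = v' := by
    by_contra hne
    obtain ⟨q, hq⟩ := hy'
    have hvq : v ∉ q.support := fun hvq =>
      hv ⟨q.takeUntil v hvq, fun hm => hq (q.support_takeUntil_subset_support hvq hm)⟩
    refine hv' (SameBranch.trans hy ⟨(SimpleGraph.Walk.cons h' q).reverse, ?_⟩)
    rw [SimpleGraph.Walk.support_reverse, List.mem_reverse, SimpleGraph.Walk.support_cons,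
      List.mem_cons, not_or]
    exact ⟨hne, hvq⟩
  subst hvv
  exact ⟨rfl, eq_of_sameBranch h h' (SameBranch.trans hy (SameBranch.symm hy'))⟩

theorem internal_subset_verts : T.internal ⊆ T.verts := fun _ h => h.1

theorem mem_leaves_or_mem_internal (h : v ∈ T.verts) : v ∈ T.leaves ∨ v ∈ T.internal := by
  by_cases h1 : T.valence v = 1
  · exact Or.inl ⟨h, h1⟩
  · exact Or.inr ⟨h, h1⟩

theorem not_mem_internal_of_leaf (h : v ∈ T.leaves) : v ∉ T.internal := fun h' => h'.2 h.2

/-- The number of edges, half the sum of the valences, is one less than the number of vertices. -/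
theorem sum_valence (T : CombTree V) (hne : T.verts.Nonempty) :
    ∑ v ∈ T.finite_verts.toFinset, T.valence v + 2 = 2 * T.finite_verts.toFinset.card := by
  classical
  have : Fintype T.verts := T.finite_verts.fintype
  have hconn : (T.graph.induce T.verts).Preconnected := by
    intro ⟨a, ha⟩ ⟨b, hb⟩
    obtain ⟨p⟩ := T.connected a ha b hb
    refine ⟨p.induce T.verts fun x hx => ?_⟩
    exact mem_verts_of_walk (p.takeUntil x hx) ha
  have : Nonempty T.verts := hne.to_subtype
  have htree : (T.graph.induce T.verts).IsTree := ⟨⟨hconn⟩, T.acyclic.induce _⟩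
  have hedge := htree.card_edgeFinset
  have hsum := (T.graph.induce T.verts).sum_degrees_eq_twice_card_edges
  have hdeg : ∀ v : T.verts, (T.graph.induce T.verts).degree v = T.valence v := by
    intro v
    rw [valence, ← SimpleGraph.card_neighborSet_eq_degree, ← Nat.card_eq_fintype_card,
      Nat.card_coe_set_eq, ← ncard_image_of_injective _ Subtype.val_injective]
    congr 1
    ext x
    constructor
    · rintro ⟨y, hy, rfl⟩
      exact hy
    · intro hx
      exact ⟨⟨x, mem_verts_right hx⟩, hx, rfl⟩
  have h1 : ∑ v ∈ T.finite_verts.toFinset, T.valence v = ∑ v : T.verts, T.valence v := by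
    refine Finset.sum_subtype _ (fun x => by simp) _
  have h2 : T.finite_verts.toFinset.card = Fintype.card T.verts := by
    rw [← Nat.card_eq_fintype_card, Nat.card_coe_set_eq, ncard_eq_toFinset_card _ T.finite_verts]
  rw [h1, h2, ← hedge, ← Finset.sum_congr rfl fun v _ => hdeg v, hsum]
  ring

end CombTree

/-! ### Compatible trees of spheres -/

namespace TreeOfSpheres

open CombTree

variable {V : Type*} {S : V → Type*} [∀ v, TopologicalSpace (S v)] {T T' : TreeOfSpheres V S}
  {v a w x : V}

theorem internal_of_adj_leaf (T : TreeOfSpheres V S) (h : T.graph.Adj v a) (ha : a ∈ T.leaves) :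
    v ∈ T.internal := by
  refine (mem_leaves_or_mem_internal (mem_verts_left h)).resolve_left fun hv => ?_
  have hsub : T.leaves ⊆ {v, a} := by
    intro x hx
    by_cases hxv : x = v
    · exact Or.inl hxv
    · obtain ⟨b, hb, hxb⟩ := exists_mem_branch (mem_verts_left h) hx.1 hxv
      rw [eq_of_leaf hv hb h, branch_leaf h ha] at hxb
      exact Or.inr hxb
  have h1 := ncard_le_ncard hsub
  have h2 := ncard_insert_le v {a}
  rw [ncard_singleton] at h2
  have h3 := T.three_le_leaves
  omega

theorem finite_attachingPoints (T : TreeOfSpheres V S) (v : V) : (T.attachingPoints v).Finite :=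
  (T.finite_neighborSet v).image _

theorem ncard_attachingPoints (hv : v ∈ T.internal) :
    (T.attachingPoints v).ncard = T.valence v :=
  (T.attach_injOn v hv).ncard_image

theorem Compatible.verts_subset (h : T.Compatible T') : T.verts ⊆ T'.verts := fun _ hv =>
  (mem_leaves_or_mem_internal hv).elim (fun hl => (h.tree.leaves_subset hl).1)
    fun hi => (h.tree.internal_subset hi).1

theorem Compatible.sameBranch (h : T.Compatible T') (hv : v ∈ T.internal) (hx : x ∈ T.verts)
    (hw : w ∈ T.verts) (hsame : T.SameBranch v x w) : T'.SameBranch v x w := by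
  have hxv := hsame.symm.ne_right
  have hwv := hsame.ne_right
  obtain ⟨e, he, hxe⟩ := exists_mem_branch hv.1 hx hxv
  obtain ⟨b, hb, c, hc, hbc, hbe, hce⟩ : ∃ b ∈ T.graph.neighborSet v, ∃ c ∈ T.graph.neighborSet v,
      b ≠ c ∧ b ≠ e ∧ c ≠ e := by
    have h3 := T.stable v hv
    have h2 : 1 < (T.graph.neighborSet v \ {e}).ncard := by
      have := ncard_sdiff_singleton_add_one (show e ∈ T.graph.neighborSet v from he)
        (T.finite_neighborSet v)
      rw [valence] at h3
      omega
    obtain ⟨b, c, hb, hc, hbc⟩ := (one_lt_ncard_iff ((T.finite_neighborSet v).sdiff)).1 h2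
    exact ⟨b, hb.1, c, hc.1, hbc, hb.2, hc.2⟩
  have key : ∀ u, u ∈ T.verts → u ≠ v → T.SameBranch v e u → T'.Separates v u b c := by
    intro u hu huv hue
    refine (h.tree.separates_iff v hv.1 u hu b (mem_verts_right hb) c (mem_verts_right hc)).1
      ⟨⟨hu, huv⟩, ⟨mem_verts_right hb, hb.ne'⟩, ⟨mem_verts_right hc, hc.ne'⟩, ?_, ?_, ?_⟩
    · exact fun hub => hbe (eq_of_sameBranch hb he (hue.trans hub).symm)
    · exact fun huc => hce (eq_of_sameBranch hc he (hue.trans huc).symm)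
    · exact fun h => hbc (eq_of_sameBranch hb hc h)
  have hx' := key x hx hxv hxe
  have hw' := key w hw hwv (SameBranch.trans hxe hsame)
  have hnot : ¬ T'.Separates v x w b := fun hsep =>
    ((h.tree.separates_iff v hv.1 x hx w hw b (mem_verts_right hb)).2 hsep).2.2.2.1 hsame
  by_contra hcon
  exact hnot ⟨hx'.1, hw'.1, hw'.2.1, hcon, hx'.2.2.2.1, hw'.2.2.2.1⟩

/-- The attaching point of the branch containing a vertex is the same in compatible trees. -/
theorem Compatible.attach_eq_of_mem_branch (h : T.Compatible T') (hv : v ∈ T.internal)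
    (hw : w ∈ T.verts) {e e' : V} (he : T.graph.Adj v e) (hwe : w ∈ T.branch v e)
    (he' : T'.graph.Adj v e') (hwe' : w ∈ T'.branch v e') : T.attach v e = T'.attach v e' := by
  obtain ⟨x, hx, hxe⟩ := exists_leaf_mem_branch v e he
  refine h.attach_eq v hv x hx e e' he hxe he' (SameBranch.trans hwe' ?_)
  exact h.sameBranch hv hw hx.1 (SameBranch.trans (SameBranch.symm hwe) hxe)

end TreeOfSpheres

/-! ### Degrees of a cover between trees of spheres -/

namespace Cover

open CombTree TreeOfSpheres

variable {V : Type*} {S : V → Type*} [∀ v, TopologicalSpace (S v)] {TY TZ : TreeOfSpheres V S}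
  (C : Cover TY TZ) {v a w : V}

theorem map_mem_verts (hv : v ∈ TY.verts) : C.F v ∈ TZ.verts :=
  (mem_leaves_or_mem_internal hv).elim (fun h => (C.map_leaves v h).1)
    fun h => (C.map_internal v h).1

theorem exists_hasTotalDegree (hv : v ∈ TY.internal) : ∃ d, HasTotalDegree (C.f v) d := by
  have := (TY.sphere v hv).compactSpace
  have := (TY.sphere v hv).t2Space
  have := (TZ.sphere _ (C.map_internal v hv)).t2Space
  have := (TZ.sphere _ (C.map_internal v hv)).connectedSpace
  exact (C.branchedCover v hv).exists_hasTotalDegree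

/-- The critical points of a cover are attaching points. -/
theorem localDegree_eq_one (hv : v ∈ TY.internal) {x : S v} (hx : x ∉ TY.attachingPoints v) :
    localDegree (C.f v) x = 1 := by
  have := (TY.sphere v hv).t2Space
  have hopen : IsOpen (TY.attachingPoints v)ᶜ :=
    (TY.finite_attachingPoints v).isClosed.isOpen_compl
  obtain ⟨e, hxe, he⟩ := (C.covering v hv).isLocalHomeomorph ⟨x, hx⟩
  have hW : Subtype.val '' e.source ∈ 𝓝 x :=
    (hopen.isOpenMap_subtype_val _ e.open_source).mem_nhds ⟨⟨x, hx⟩, hxe, rfl⟩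
  refine localDegree_eq_one_of_injOn (C.branchedCover v hv) hW ?_
  rintro _ ⟨y, hy, rfl⟩ _ ⟨y', hy', rfl⟩ hyy
  refine congrArg _ (e.injOn hy hy' ?_)
  rw [← he]
  exact Subtype.ext hyy

theorem preimage_attach (hv : v ∈ TY.internal) {b : V} (hb : TZ.graph.Adj (C.F v) b) :
    C.f v ⁻¹' {TZ.attach (C.F v) b} = TY.attach v '' {a | TY.graph.Adj v a ∧ C.F a = b} := by
  ext x
  constructor
  · intro hx
    have hxA : x ∈ TY.attachingPoints v := by
      by_contra hcon
      exact C.mapsTo v hv hcon ⟨b, hb, (show C.f v x = _ from hx).symm⟩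
    obtain ⟨a, ha, rfl⟩ := hxA
    refine ⟨a, ⟨ha, ?_⟩, rfl⟩
    rw [mem_preimage, C.map_attach v hv a ha] at hx
    exact TZ.attach_injOn _ (C.map_internal v hv) (C.map_adj v a ha) hb hx
  · rintro ⟨a, ⟨ha, rfl⟩, rfl⟩
    exact C.map_attach v hv a ha

theorem preimage_attachingPoints (hv : v ∈ TY.internal) :
    C.f v ⁻¹' TZ.attachingPoints (C.F v) = TY.attachingPoints v := by
  ext x
  constructor
  · intro hx
    by_contra hcon
    exact C.mapsTo v hv hcon hx
  · rintro ⟨a, ha, rfl⟩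
    exact ⟨C.F a, C.map_adj v a ha, (C.map_attach v hv a ha).symm⟩

open Classical in
/-- The degree of the cover along the edge `{v, a}`: the local degree at the attaching point of the
edge on the sphere of either of its ends that is internal. -/
noncomputable def edgeDegree (v a : V) : ℕ :=
  if v ∈ TY.internal then localDegree (C.f v) (TY.attach v a)
  else localDegree (C.f a) (TY.attach a v)

open Classical in
/-- The degree of the cover at a vertex; at a leaf this is the degree along the edge of the leaf. -/
noncomputable def vertexDegree (v : V) : ℕ :=
  if h : v ∈ TY.internal then (C.exists_hasTotalDegree h).choose
  else ∑ᶠ a ∈ TY.graph.neighborSet v, C.edgeDegree v a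

theorem edgeDegree_of_internal (hv : v ∈ TY.internal) :
    C.edgeDegree v a = localDegree (C.f v) (TY.attach v a) := if_pos hv

theorem edgeDegree_comm (h : TY.graph.Adj v a) : C.edgeDegree v a = C.edgeDegree a v := by
  rcases mem_leaves_or_mem_internal (mem_verts_left h) with hv | hv <;>
    rcases mem_leaves_or_mem_internal (mem_verts_right h) with ha | ha
  · exact (not_mem_internal_of_leaf hv (TY.internal_of_adj_leaf h ha)).elim
  · rw [edgeDegree, if_neg (not_mem_internal_of_leaf hv), edgeDegree, if_pos ha]
  · rw [edgeDegree, if_pos hv, edgeDegree, if_neg (not_mem_internal_of_leaf ha)]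
  · rw [edgeDegree, if_pos hv, edgeDegree, if_pos ha, C.edge_degree v hv a ha h]

theorem edgeDegree_pos (h : TY.graph.Adj v a) : 0 < C.edgeDegree v a := by
  rcases mem_leaves_or_mem_internal (mem_verts_left h) with hv | hv
  · have ha := TY.internal_of_adj_leaf h.symm hv
    rw [C.edgeDegree_comm h, C.edgeDegree_of_internal ha]
    exact (C.branchedCover a ha).localDegree_pos _
  · rw [C.edgeDegree_of_internal hv]
    exact (C.branchedCover v hv).localDegree_pos _

theorem hasTotalDegree (hv : v ∈ TY.internal) : HasTotalDegree (C.f v) (C.vertexDegree v) := by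
  rw [vertexDegree, dif_pos hv]
  exact (C.exists_hasTotalDegree hv).choose_spec

theorem vertexDegree_of_leaf (hv : v ∈ TY.leaves) (ha : TY.graph.Adj v a) :
    C.vertexDegree v = C.edgeDegree v a := by
  have : TY.graph.neighborSet v = {a} := by
    ext b
    exact ⟨fun hb => eq_of_leaf hv hb ha, by rintro rfl; exact ha⟩
  rw [vertexDegree, dif_neg (not_mem_internal_of_leaf hv), this, finsum_mem_singleton]

/-- The degree at a vertex is the sum of the degrees along the edges over a given edge. -/
theorem finsum_edgeDegree {b : V} (hv : v ∈ TY.verts) (hb : TZ.graph.Adj (C.F v) b) :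
    ∑ᶠ a ∈ {a | TY.graph.Adj v a ∧ C.F a = b}, C.edgeDegree v a = C.vertexDegree v := by
  rcases mem_leaves_or_mem_internal hv with hl | hi
  · obtain ⟨a, ha⟩ := ncard_eq_one.1 hl.2
    have ha' : TY.graph.Adj v a := by
      have : a ∈ TY.graph.neighborSet v := by rw [ha]; rfl
      exact this
    have hset : {a | TY.graph.Adj v a ∧ C.F a = b} = {a} := by
      ext c
      refine ⟨fun hc => eq_of_leaf hl hc.1 ha', ?_⟩
      rintro rfl
      exact ⟨ha', eq_of_leaf (C.map_leaves v hl) (C.map_adj v _ ha') hb⟩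
    rw [hset, finsum_mem_singleton, C.vertexDegree_of_leaf hl ha']
  · rw [← (C.hasTotalDegree hi (TZ.attach (C.F v) b)).2, C.preimage_attach hi hb,
      finsum_mem_image ((TY.attach_injOn v hi).mono fun a ha => ha.1)]
    exact finsum_mem_congr rfl fun a _ => C.edgeDegree_of_internal hi

open Classical in
theorem sum_edgeDegree {b : V} (hv : v ∈ TY.verts) (hb : TZ.graph.Adj (C.F v) b) :
    ∑ a ∈ TY.finite_verts.toFinset with TY.graph.Adj v a ∧ C.F a = b, C.edgeDegree v a =
      C.vertexDegree v := by
  rw [← C.finsum_edgeDegree hv hb, ← finsum_mem_coe_finset]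
  refine finsum_mem_congr ?_ fun _ _ => rfl
  ext a
  simp only [Finset.coe_filter, Finite.mem_toFinset, mem_ofPred_eq]
  exact ⟨fun h => h.2, fun h => ⟨mem_verts_right h.1, h⟩⟩

open Classical in
/-- The total degree of the cover over a vertex of the target. -/
noncomputable def fiberDegree (w : V) : ℕ :=
  ∑ v ∈ TY.finite_verts.toFinset with C.F v = w, C.vertexDegree v

theorem fiberDegree_eq_of_adj {w' : V} (h : TZ.graph.Adj w w') :
    C.fiberDegree w = C.fiberDegree w' := by
  classical
  have key : ∀ {w w' : V}, TZ.graph.Adj w w' → C.fiberDegree w =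
      ∑ v ∈ TY.finite_verts.toFinset, ∑ a ∈ TY.finite_verts.toFinset,
        if C.F v = w ∧ C.F a = w' ∧ TY.graph.Adj v a then C.edgeDegree v a else 0 := by
    intro w w' h
    rw [fiberDegree, Finset.sum_filter]
    refine Finset.sum_congr rfl fun v hv => ?_
    split_ifs with hvw
    · rw [← C.sum_edgeDegree ((Finite.mem_toFinset _).1 hv) (by rw [hvw]; exact h),
        Finset.sum_filter]
      refine Finset.sum_congr rfl fun a _ => ?_
      simp only [hvw, true_and, and_comm]
    · simp [hvw]
  rw [key h, key h.symm, Finset.sum_comm]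
  refine Finset.sum_congr rfl fun a _ => Finset.sum_congr rfl fun v _ => ?_
  by_cases hva : TY.graph.Adj v a
  · simp only [hva, hva.symm, and_true, C.edgeDegree_comm hva]
    exact if_congr and_comm rfl rfl
  · have : ¬ TY.graph.Adj a v := fun h => hva h.symm
    simp [hva, this]

theorem fiberDegree_eq {w w' : V} (hw : w ∈ TZ.verts) (hw' : w' ∈ TZ.verts) :
    C.fiberDegree w = C.fiberDegree w' := by
  obtain ⟨p⟩ := TZ.connected w hw w' hw'
  clear hw hw'
  induction p with
  | nil => rfl
  | cons h _ ih => exact (C.fiberDegree_eq_of_adj h).trans ih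

theorem hasDegree_fiberDegree (hw : w ∈ TZ.verts) : C.HasDegree (C.fiberDegree w) := by
  classical
  refine ⟨C.vertexDegree, fun v hv => C.hasTotalDegree hv, fun y hy v hvy => ?_, fun w' hw' => ?_⟩
  · rw [C.vertexDegree_of_leaf hy hvy.symm, ← C.edgeDegree_comm hvy,
      C.edgeDegree_of_internal (TY.internal_of_adj_leaf hvy hy)]
  · rw [C.fiberDegree_eq hw hw', fiberDegree, ← finsum_mem_coe_finset]
    refine finsum_mem_congr ?_ fun _ _ => rfl
    ext v
    simp

theorem vertexDegree_pos (hv : v ∈ TY.verts) : 0 < C.vertexDegree v := by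
  rcases mem_leaves_or_mem_internal hv with hl | hi
  · obtain ⟨a, ha⟩ := ncard_eq_one.1 hl.2
    have ha' : a ∈ TY.graph.neighborSet v := by rw [ha]; rfl
    rw [C.vertexDegree_of_leaf hl ha']
    exact C.edgeDegree_pos ha'
  · have := (TY.sphere v hi).connectedSpace
    exact (C.hasTotalDegree hi).pos (C.branchedCover v hi)

/-! ### The number of critical leaves -/

/-- The Riemann–Hurwitz inequality at an internal vertex. -/
theorem valence_mul_vertexDegree_le (hv : v ∈ TY.internal) :
    TZ.valence (C.F v) * C.vertexDegree v + 2 ≤ TY.valence v + 2 * C.vertexDegree v := by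
  have hFv := C.map_internal v hv
  have h := riemannHurwitz_le (TY.sphere v hv) (TZ.sphere _ hFv) (C.branchedCover v hv)
    (C.hasTotalDegree hv) (TZ.finite_attachingPoints (C.F v))
    (by rw [ncard_attachingPoints hFv]; have := TZ.stable _ hFv; omega)
    (fun x hx => C.localDegree_eq_one hv fun hxA => hx (by
      rwa [← mem_preimage, C.preimage_attachingPoints hv]))
  rwa [C.preimage_attachingPoints hv, ncard_attachingPoints hFv, ncard_attachingPoints hv] at h

theorem sum_valence_mul_vertexDegree (hw : w ∈ TZ.verts) :
    ∑ v ∈ TY.finite_verts.toFinset, TZ.valence (C.F v) * C.vertexDegree v + 2 * C.fiberDegree w =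
      2 * C.fiberDegree w * TZ.finite_verts.toFinset.card := by
  classical
  have h1 : ∑ v ∈ TY.finite_verts.toFinset, TZ.valence (C.F v) * C.vertexDegree v =
      ∑ w' ∈ TZ.finite_verts.toFinset, TZ.valence w' * C.fiberDegree w := by
    rw [← Finset.sum_fiberwise_of_maps_to (t := TZ.finite_verts.toFinset) (g := C.F) fun v hv => by
      rw [Finite.mem_toFinset] at hv ⊢
      exact C.map_mem_verts hv]
    refine Finset.sum_congr rfl fun w' hw' => ?_
    rw [C.fiberDegree_eq hw ((Finite.mem_toFinset _).1 hw'), fiberDegree, Finset.mul_sum]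
    refine Finset.sum_congr rfl fun v hv => ?_
    rw [(Finset.mem_filter.1 hv).2]
  have h2 := TZ.sum_valence ⟨w, hw⟩
  rw [h1, ← Finset.sum_mul]
  linear_combination C.fiberDegree w * h2

theorem sum_vertexDegree (hw : w ∈ TZ.verts) :
    ∑ v ∈ TY.finite_verts.toFinset, C.vertexDegree v =
      C.fiberDegree w * TZ.finite_verts.toFinset.card := by
  classical
  rw [← Finset.sum_fiberwise_of_maps_to (t := TZ.finite_verts.toFinset) (g := C.F) fun v hv => by
      rw [Finite.mem_toFinset] at hv ⊢
      exact C.map_mem_verts hv]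
  rw [Finset.sum_congr rfl fun w' hw' => show _ = C.fiberDegree w from ?_, Finset.sum_const,
    smul_eq_mul, mul_comm]
  rw [C.fiberDegree_eq hw ((Finite.mem_toFinset _).1 hw')]
  rfl

/-- The set of leaves of the target over which some leaf has degree greater than one. -/
def criticalValueLeaves : Set V := {w | ∃ y ∈ TY.leaves, C.F y = w ∧ C.vertexDegree y ≠ 1}

theorem criticalValueLeaves_subset : C.criticalValueLeaves ⊆ TZ.leaves := by
  rintro _ ⟨y, hy, rfl, -⟩
  exact C.map_leaves y hy

/-- A cover of degree `D` has at most `2 * D - 2` critical leaves, hence at most that many leaves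
of the target are critical values. -/
theorem ncard_criticalValueLeaves_add_two_le (hw : w ∈ TZ.verts) :
    C.criticalValueLeaves.ncard + 2 ≤ 2 * C.fiberDegree w := by
  classical
  let VY := TY.finite_verts.toFinset
  let m : V → ℕ := fun v => if v ∈ TY.leaves then C.vertexDegree v - 1 else 0
  have hm : C.criticalValueLeaves.ncard ≤ ∑ v ∈ VY, m v := by
    let A := VY.filter fun y => y ∈ TY.leaves ∧ C.vertexDegree y ≠ 1
    have hsub : C.criticalValueLeaves ⊆ ((A.image C.F : Finset V) : Set V) := by
      rintro w ⟨y, hy, rfl, hy1⟩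
      refine Finset.mem_coe.2 (Finset.mem_image_of_mem _ (Finset.mem_filter.2 ⟨?_, hy, hy1⟩))
      exact (Finite.mem_toFinset _).2 hy.1
    calc C.criticalValueLeaves.ncard ≤ (A.image C.F).card := by
          rw [← ncard_coe_finset]
          exact ncard_le_ncard hsub (Finset.finite_toSet _)
      _ ≤ A.card := Finset.card_image_le
      _ ≤ ∑ v ∈ A, m v := by
          rw [Finset.card_eq_sum_ones]
          refine Finset.sum_le_sum fun y hy => ?_
          obtain ⟨hyV, hyl, hy1⟩ := Finset.mem_filter.1 hy
          have := C.vertexDegree_pos ((Finite.mem_toFinset _).1 hyV)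
          simp only [m, if_pos hyl]
          omega
      _ ≤ ∑ v ∈ VY, m v :=
          Finset.sum_le_sum_of_subset (Finset.filter_subset _ _)
  have hle : ∀ v ∈ VY, TZ.valence (C.F v) * C.vertexDegree v + 2 + m v ≤
      TY.valence v + 2 * C.vertexDegree v := by
    intro v hv
    have hv := (Finite.mem_toFinset _).1 hv
    have hpos := C.vertexDegree_pos hv
    rcases mem_leaves_or_mem_internal hv with hl | hi
    · rw [hl.2, (C.map_leaves v hl).2]
      simp only [m, if_pos hl]
      omega
    · have := C.valence_mul_vertexDegree_le hi
      have hnl : v ∉ TY.leaves := fun hl => not_mem_internal_of_leaf hl hi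
      simp only [m, if_neg hnl]
      omega
  have hsum := Finset.sum_le_sum hle
  simp only [Finset.sum_add_distrib, Finset.sum_const, smul_eq_mul, ← Finset.mul_sum] at hsum
  have h1 := C.sum_valence_mul_vertexDegree hw
  have h2 := C.sum_vertexDegree hw
  have hne : TY.verts.Nonempty := by
    have := TY.three_le_leaves
    obtain ⟨y, hy⟩ := nonempty_of_ncard_ne_zero (s := TY.leaves) (by omega)
    exact ⟨y, hy.1⟩
  have h3 := TY.sum_valence hne
  simp only [VY] at hsum hm
  rw [h2, ← mul_assoc] at hsum
  omega

/-! ### Branches without critical values -/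

/-- The cover is unramified over a branch of the target that contains no critical value among its
leaves: along every edge over its root edge the degree is one, and the branch there is mapped
into it. -/
theorem edgeDegree_eq_one_of_branch : ∀ w' a', TZ.graph.Adj w' a' →
    Disjoint C.criticalValueLeaves (TZ.branch w' a') →
    ∀ w a, TY.graph.Adj w a → C.F w = w' → C.F a = a' →
      C.edgeDegree w a = 1 ∧ MapsTo C.F (TY.branch w a) (TZ.branch w' a') := by
  classical
  refine branch_induction fun w' a' h' ih hdisj w a h hw ha => ?_
  have haV := mem_verts_right h
  rcases mem_leaves_or_mem_internal haV with hl | hi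
  · constructor
    · rw [C.edgeDegree_comm h, ← C.vertexDegree_of_leaf hl h.symm]
      by_contra hne
      exact disjoint_left.1 hdisj ⟨a, hl, ha, hne⟩ (self_mem_branch h')
    · rw [branch_leaf h hl]
      rintro _ rfl
      rw [ha]
      exact self_mem_branch h'
  have hih : ∀ b, TY.graph.Adj a b → C.F b ≠ w' → C.edgeDegree a b = 1 ∧
      MapsTo C.F (TY.branch a b) (TZ.branch a' (C.F b)) := by
    intro b hab hbw
    have hab' : TZ.graph.Adj a' (C.F b) := ha ▸ C.map_adj a b hab
    refine ih (C.F b) hab' hbw (hdisj.mono_right fun x hx => ?_) a b hab ha rfl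
    exact (mem_branch_iff h').2 (Or.inr ⟨C.F b, hab', hbw, hx⟩)
  -- The covering of the sphere at `a` is unramified away from the point of the root edge.
  have hdeg : C.vertexDegree a = 1 := by
    refine HasTotalDegree.eq_one (TY.sphere a hi) (TZ.sphere _ (C.map_internal a hi))
      (C.branchedCover a hi) (C.hasTotalDegree hi) (TZ.attach (C.F a) w') fun x hx => ?_
    by_cases hxA : x ∈ TY.attachingPoints a
    · obtain ⟨b, hab, rfl⟩ := hxA
      rw [← C.edgeDegree_of_internal hi]
      refine (hih b hab fun hbw => hx ?_).1
      rw [C.map_attach a hi b hab, hbw]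
    · exact C.localDegree_eq_one hi hxA
  have hadj : TZ.graph.Adj (C.F a) w' := ha ▸ h'.symm
  have hsum := C.sum_edgeDegree haV hadj
  rw [hdeg] at hsum
  have hmem : ∀ b, TY.graph.Adj a b → C.F b = w' →
      b ∈ TY.finite_verts.toFinset.filter fun b => TY.graph.Adj a b ∧ C.F b = w' := fun b hab hb =>
    Finset.mem_filter.2 ⟨(Finite.mem_toFinset _).2 (mem_verts_right hab), hab, hb⟩
  have hone : ∀ b, TY.graph.Adj a b → C.F b = w' → b = w := by
    intro b hab hb
    by_contra hne
    have h1 := Finset.add_le_sum (f := C.edgeDegree a) (fun _ _ => Nat.zero_le _)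
      (hmem b hab hb) (hmem w h.symm hw) hne
    have h2 := C.edgeDegree_pos hab
    have h3 := C.edgeDegree_pos h.symm
    omega
  refine ⟨?_, fun x hx => ?_⟩
  · rw [C.edgeDegree_comm h]
    have h1 := Finset.single_le_sum (f := C.edgeDegree a) (fun _ _ => Nat.zero_le _)
      (hmem w h.symm hw)
    have h3 := C.edgeDegree_pos h.symm
    omega
  · rcases (mem_branch_iff h).1 hx with rfl | ⟨b, hab, hbw, hxb⟩
    · rw [ha]
      exact self_mem_branch h'
    · have hbw' : C.F b ≠ w' := fun hb => hbw (hone b hab hb)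
      refine (mem_branch_iff h').2 (Or.inr ⟨C.F b, ha ▸ C.map_adj a b hab, hbw', ?_⟩)
      exact (hih b hab hbw').2 hxb

end Cover

/-! ### Orbits and grand orbits -/

namespace DynSystem

open CombTree TreeOfSpheres

variable {V : Type*} {S : V → Type*} [∀ v, TopologicalSpace (S v)] (𝓕 : DynSystem V S)
  {z z' z'' c : Σ v, S v}

theorem step_iterate_fst (k : ℕ) (z : Σ v, S v) : (𝓕.step^[k] z).1 = 𝓕.cover.F^[k] z.1 := by
  induction k generalizing z with
  | zero => rfl
  | succ k ih => exact ih (𝓕.step z)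

theorem self_mem_orbit : z ∈ 𝓕.orbit z := ⟨0, fun j hj => absurd hj (Nat.not_lt_zero j), rfl⟩

theorem mem_grandOrbit_self (hz : z ∈ 𝓕.points) : z ∈ 𝓕.grandOrbit z :=
  ⟨hz, z, 𝓕.self_mem_orbit, 𝓕.self_mem_orbit⟩

theorem exists_iterate_eq (h : (𝓕.orbit z ∩ 𝓕.orbit z').Nonempty) : ∃ k l,
    z.1 ∈ 𝓕.iterDomain k ∧ z'.1 ∈ 𝓕.iterDomain l ∧ 𝓕.step^[k] z = 𝓕.step^[l] z' := by
  obtain ⟨_, ⟨k, hk, rfl⟩, l, hl, h⟩ := h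
  exact ⟨k, l, hk, hl, h.symm⟩

theorem iterDomain_add {k l n : ℕ} (hk : z.1 ∈ 𝓕.iterDomain k)
    (heq : 𝓕.step^[k] z = 𝓕.step^[l] z') (hn : z'.1 ∈ 𝓕.iterDomain (l + n)) :
    z.1 ∈ 𝓕.iterDomain (k + n) := by
  intro j hj
  by_cases hjk : j < k
  · exact hk j hjk
  · obtain ⟨i, rfl⟩ := Nat.exists_eq_add_of_le (not_lt.1 hjk)
    have h1 := congrArg Sigma.fst heq
    rw [step_iterate_fst, step_iterate_fst] at h1
    rw [add_comm, Function.iterate_add_apply, h1, ← Function.iterate_add_apply]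
    exact hn _ (by omega)

theorem iterate_add_eq {k l : ℕ} (n : ℕ) (heq : 𝓕.step^[k] z = 𝓕.step^[l] z') :
    𝓕.step^[k + n] z = 𝓕.step^[l + n] z' := by
  rw [add_comm k, add_comm l, Function.iterate_add_apply, Function.iterate_add_apply, heq]

theorem orbit_inter_trans (h : (𝓕.orbit z ∩ 𝓕.orbit z').Nonempty)
    (h' : (𝓕.orbit z' ∩ 𝓕.orbit z'').Nonempty) : (𝓕.orbit z ∩ 𝓕.orbit z'').Nonempty := by
  obtain ⟨k, l, hk, hl, h1⟩ := 𝓕.exists_iterate_eq h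
  obtain ⟨m, n, hm, hn, h2⟩ := 𝓕.exists_iterate_eq h'
  rcases le_total l m with hlm | hml
  · obtain ⟨i, rfl⟩ := Nat.exists_eq_add_of_le hlm
    refine ⟨𝓕.step^[k + i] z, ⟨k + i, 𝓕.iterDomain_add hk h1 hm, rfl⟩, n, hn, ?_⟩
    rw [𝓕.iterate_add_eq i h1, h2]
  · obtain ⟨i, rfl⟩ := Nat.exists_eq_add_of_le hml
    refine ⟨𝓕.step^[k] z, ⟨k, hk, rfl⟩, n + i, 𝓕.iterDomain_add hn h2.symm hl, ?_⟩
    rw [h1, 𝓕.iterate_add_eq i h2]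

theorem grandOrbit_eq (h : (𝓕.orbit z ∩ 𝓕.orbit z').Nonempty) :
    𝓕.grandOrbit z = 𝓕.grandOrbit z' := by
  ext w
  refine and_congr_right fun _ => ⟨fun hw => ?_, fun hw => 𝓕.orbit_inter_trans h hw⟩
  exact 𝓕.orbit_inter_trans (by rwa [inter_comm]) hw

theorem mem_prep_of_infinite (h : (𝓕.orbit c).Infinite) : c.1 ∈ 𝓕.prep := by
  intro k
  by_contra hk
  refine h ((finite_Iio k |>.image fun j => 𝓕.step^[j] c).subset ?_)
  rintro _ ⟨j, hj, rfl⟩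
  refine ⟨j, ?_, rfl⟩
  by_contra hjk
  exact hk fun i hi => hj i (lt_of_lt_of_le hi (not_lt.1 hjk))

theorem iterate_mem_internal {v : V} (h : v ∈ 𝓕.prep) (k : ℕ) :
    𝓕.cover.F^[k] v ∈ 𝓕.TX.internal := h (k + 1) k (Nat.lt_succ_self k)

theorem iterate_mem_prep {v : V} (h : v ∈ 𝓕.prep) (k : ℕ) : 𝓕.cover.F^[k] v ∈ 𝓕.prep := by
  intro n j _
  rw [← Function.iterate_add_apply]
  exact 𝓕.iterate_mem_internal h _

theorem iterate_injective (h : (𝓕.orbit c).Infinite) :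
    Function.Injective fun k => 𝓕.step^[k] c := by
  -- A coincidence `z_k = z_l` with `k < l` makes the orbit eventually periodic.
  have key : ∀ k l, k < l → 𝓕.step^[k] c ≠ 𝓕.step^[l] c := by
    intro k l hkl heq
    have hsub : ∀ n, 𝓕.step^[n] c ∈ (fun j => 𝓕.step^[j] c) '' Iio l := by
      intro n
      induction n using Nat.strong_induction_on with
      | _ n ih =>
        by_cases hn : n < l
        · exact ⟨n, hn, rfl⟩
        · obtain ⟨i, rfl⟩ := Nat.exists_eq_add_of_le (not_lt.1 hn)
          rw [← 𝓕.iterate_add_eq i heq]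
          exact ih _ (by omega)
    refine h (((finite_Iio l).image fun j => 𝓕.step^[j] c).subset ?_)
    rintro _ ⟨j, -, rfl⟩
    exact hsub j
  intro k l hkl
  rcases lt_trichotomy k l with h | h | h
  · exact (key k l h hkl).elim
  · exact h
  · exact (key l k h hkl.symm).elim

theorem finite_setOf_attaching (h : (𝓕.orbit c).Infinite) :
    {k | (𝓕.step^[k] c).2 ∈ 𝓕.TZ.attachingPoints (𝓕.step^[k] c).1}.Finite := by
  have hfin : (⋃ v ∈ 𝓕.TX.internal, Sigma.mk v '' 𝓕.TZ.attachingPoints v).Finite :=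
    (𝓕.TX.finite_verts.subset internal_subset_verts).biUnion fun v _ =>
      (𝓕.TZ.finite_attachingPoints v).image _
  refine Finite.of_finite_image (f := fun k => 𝓕.step^[k] c) (hfin.subset ?_)
    (𝓕.iterate_injective h).injOn
  rintro _ ⟨k, hk, rfl⟩
  refine mem_biUnion (x := (𝓕.step^[k] c).1) ?_ ⟨_, hk, rfl⟩
  rw [step_iterate_fst]
  exact 𝓕.iterate_mem_internal (𝓕.mem_prep_of_infinite h) k

/-! ### The last critical value branch along an orbit -/

/-- If a branch of `TZ` at a vertex `v` of `TX` contains an internal vertex `w` of `TX`, then its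
attaching point is that of an edge of `TY`, pointing to a branch of `TY` that contains `w`. -/
theorem exists_source_edge {v w e : V} (hv : v ∈ 𝓕.TX.internal) (hw : w ∈ 𝓕.TX.internal)
    (he : 𝓕.TZ.graph.Adj v e) (hwe : w ∈ 𝓕.TZ.branch v e) :
    ∃ a, 𝓕.TY.graph.Adj v a ∧ w ∈ 𝓕.TY.branch v a ∧ 𝓕.TZ.attach v e = 𝓕.TY.attach v a := by
  have hwv : w ≠ v := SameBranch.ne_right hwe
  obtain ⟨x, hx, hwx⟩ := exists_mem_branch hv.1 hw.1 hwv
  obtain ⟨a, ha, hwa⟩ := exists_mem_branch (𝓕.compatible_source.verts_subset hv.1)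
    (𝓕.compatible_source.verts_subset hw.1) hwv
  refine ⟨a, ha, hwa, ?_⟩
  rw [← 𝓕.compatible_target.attach_eq_of_mem_branch hv hw.1 hx hwx he hwe,
    𝓕.compatible_source.attach_eq_of_mem_branch hv hw.1 hx hwx ha hwa]

/-- The forward orbit of a critical point with infinite orbit visits the attaching point of a branch
of `TZ` that contains a critical value leaf but no vertex with infinite itinerary. -/
theorem exists_critical_branch (hc : 𝓕.IsCritical c) (h : (𝓕.orbit c).Infinite) :
    ∃ k e, 𝓕.TZ.graph.Adj (𝓕.step^[k] c).1 e ∧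
      (𝓕.step^[k] c).2 = 𝓕.TZ.attach (𝓕.step^[k] c).1 e ∧
      (∃ y ∈ 𝓕.cover.criticalValueLeaves, y ∈ 𝓕.TZ.branch (𝓕.step^[k] c).1 e) ∧
      ∀ w ∈ 𝓕.prep, w ∉ 𝓕.TZ.branch (𝓕.step^[k] c).1 e := by
  have hprep := 𝓕.mem_prep_of_infinite h
  let A : Set ℕ := {k | ∃ e, 𝓕.TZ.graph.Adj (𝓕.step^[k] c).1 e ∧
      (𝓕.step^[k] c).2 = 𝓕.TZ.attach (𝓕.step^[k] c).1 e ∧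
      ∃ y ∈ 𝓕.cover.criticalValueLeaves, y ∈ 𝓕.TZ.branch (𝓕.step^[k] c).1 e}
  have hAfin : A.Finite := (𝓕.finite_setOf_attaching h).subset fun k ⟨e, he, hke, _⟩ =>
    ⟨e, he, hke.symm⟩
  have hXY : ∀ k, (𝓕.step^[k] c).1 ∈ 𝓕.TX.internal := fun k => by
    rw [step_iterate_fst]
    exact 𝓕.iterate_mem_internal hprep k
  -- At an attaching point of the orbit whose image is not in `A`, the cover has degree one and maps
  -- the branch of `TY` into the branch of `TZ` at the image.
  have hstep : ∀ k a, 𝓕.TY.graph.Adj (𝓕.step^[k] c).1 a →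
      (𝓕.step^[k] c).2 = 𝓕.TY.attach (𝓕.step^[k] c).1 a →
      𝓕.TZ.graph.Adj (𝓕.step^[k + 1] c).1 (𝓕.cover.F a) ∧
      (𝓕.step^[k + 1] c).2 = 𝓕.TZ.attach (𝓕.step^[k + 1] c).1 (𝓕.cover.F a) ∧
      (k + 1 ∉ A → 𝓕.cover.edgeDegree (𝓕.step^[k] c).1 a = 1 ∧
        MapsTo 𝓕.cover.F (𝓕.TY.branch (𝓕.step^[k] c).1 a)
          (𝓕.TZ.branch (𝓕.step^[k + 1] c).1 (𝓕.cover.F a))) := by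
    intro k a ha hka
    have hY := 𝓕.compatible_source.tree.internal_subset (hXY k)
    rw [Function.iterate_succ_apply']
    have hadj : 𝓕.TZ.graph.Adj (𝓕.step (𝓕.step^[k] c)).1 (𝓕.cover.F a) :=
      𝓕.cover.map_adj _ a ha
    have hatt : (𝓕.step (𝓕.step^[k] c)).2 =
        𝓕.TZ.attach (𝓕.step (𝓕.step^[k] c)).1 (𝓕.cover.F a) := by
      have := 𝓕.cover.map_attach _ hY a ha
      rw [← hka] at this
      exact this
    refine ⟨hadj, hatt, fun hkA => ?_⟩
    refine 𝓕.cover.edgeDegree_eq_one_of_branch _ _ hadj ?_ _ a ha rfl rfl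
    refine disjoint_left.2 fun y hy hyb => hkA ?_
    have hmem : ∃ e, 𝓕.TZ.graph.Adj (𝓕.step (𝓕.step^[k] c)).1 e ∧
        (𝓕.step (𝓕.step^[k] c)).2 = 𝓕.TZ.attach (𝓕.step (𝓕.step^[k] c)).1 e ∧
        ∃ y ∈ 𝓕.cover.criticalValueLeaves, y ∈ 𝓕.TZ.branch (𝓕.step (𝓕.step^[k] c)).1 e :=
      ⟨_, hadj, hatt, y, hy, hyb⟩
    rwa [← Function.iterate_succ_apply' 𝓕.step k c] at hmem
  have h1A : 1 ∈ A := by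
    have hcA : c.2 ∈ 𝓕.TY.attachingPoints c.1 := by
      by_contra hcon
      have := 𝓕.cover.localDegree_eq_one hc.1 hcon
      have := hc.2
      omega
    obtain ⟨a, ha, hca⟩ := hcA
    obtain ⟨-, -, h3⟩ := hstep 0 a ha hca.symm
    by_contra hcon
    have h4 := (h3 hcon).1
    have h5 : 𝓕.cover.edgeDegree c.1 a = localDegree (𝓕.cover.f c.1) c.2 := by
      rw [← hca]
      exact 𝓕.cover.edgeDegree_of_internal hc.1
    have := hc.2
    have h6 : 𝓕.cover.edgeDegree c.1 a = 1 := h4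
    omega
  obtain ⟨k, hkA, hmax⟩ := hAfin.exists_maximal ⟨1, h1A⟩
  obtain ⟨e, he, hke, hy⟩ := hkA
  refine ⟨k, e, he, hke, hy, fun w hw hwe => ?_⟩
  -- A vertex with infinite itinerary in the branch would follow the orbit forever.
  have hfollow : ∀ j, ∃ e, 𝓕.TZ.graph.Adj (𝓕.step^[k + j] c).1 e ∧
      (𝓕.step^[k + j] c).2 = 𝓕.TZ.attach (𝓕.step^[k + j] c).1 e ∧
      𝓕.cover.F^[j] w ∈ 𝓕.TZ.branch (𝓕.step^[k + j] c).1 e := by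
    intro j
    induction j with
    | zero => exact ⟨e, he, hke, hwe⟩
    | succ j ih =>
      obtain ⟨e, he, hke, hwe⟩ := ih
      obtain ⟨a, ha, hwa, hea⟩ :=
        𝓕.exists_source_edge (hXY (k + j)) (𝓕.iterate_mem_internal hw j) he hwe
      obtain ⟨h1, h2, h3⟩ := hstep (k + j) a ha (hke.trans hea)
      refine ⟨_, h1, h2, ?_⟩
      rw [Function.iterate_succ_apply']
      refine (h3 fun hA => ?_).2 hwa
      have := hmax hA (by omega)
      omega
  refine (𝓕.finite_setOf_attaching h).not_infinite ?_
  refine (infinite_range_of_injective (add_right_injective k)).mono ?_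
  rintro _ ⟨j, rfl⟩
  obtain ⟨e, he, hke, -⟩ := hfollow j
  exact ⟨e, he, hke.symm⟩

/-- Distinct grand orbits of critical points with infinite orbit have distinct critical value
leaves. -/
theorem encard_infiniteCriticalGrandOrbits_le :
    𝓕.infiniteCriticalGrandOrbits.encard ≤ 𝓕.cover.criticalValueLeaves.encard := by
  have hex : ∀ G : 𝓕.infiniteCriticalGrandOrbits, ∃ c, G = 𝓕.grandOrbit c ∧ 𝓕.IsCritical c ∧
      (𝓕.orbit c).Infinite := by
    rintro ⟨G, ⟨z, hz, rfl⟩, c, hcG, hc, hinf⟩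
    exact ⟨c, 𝓕.grandOrbit_eq hcG.2, hc, hinf⟩
  choose c hG hc hinf using hex
  choose k e he hke hy hprep using fun G => 𝓕.exists_critical_branch (hc G) (hinf G)
  choose y hy hyb using hy
  have hv : ∀ G, (𝓕.step^[k G] (c G)).1 ∈ 𝓕.prep := fun G => by
    rw [step_iterate_fst]
    exact 𝓕.iterate_mem_prep (𝓕.mem_prep_of_infinite (hinf G)) _
  have hinj : Function.Injective y := by
    intro G G' hyy
    obtain ⟨h1, h2⟩ := branch_eq_of_meet (he G) (he G') (hyb G) (hyy ▸ hyb G')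
      (hprep G _ (hv G')) (hprep G' _ (hv G))
    have hz : 𝓕.step^[k G] (c G) = 𝓕.step^[k G'] (c G') := by
      have key : ∀ (z z' : Σ v, S v) (e e' : V), z.1 = z'.1 → e = e' →
          z.2 = 𝓕.TZ.attach z.1 e → z'.2 = 𝓕.TZ.attach z'.1 e' → z = z' := by
        rintro ⟨v, z⟩ ⟨v', z'⟩ e e' rfl rfl h h'
        simp only at h h'
        rw [h, h']
      exact key _ _ _ _ h1 h2 (hke G) (hke G')
    refine Subtype.ext ((hG G).trans (Eq.trans ?_ (hG G').symm))
    refine 𝓕.grandOrbit_eq ⟨_, ⟨k G, 𝓕.mem_prep_of_infinite (hinf G) _, rfl⟩,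
      k G', 𝓕.mem_prep_of_infinite (hinf G') _, hz.symm⟩
  exact Function.Embedding.encard_le ⟨fun G => ⟨y G, hy G⟩, fun G G' h =>
    hinj (congrArg Subtype.val h)⟩

theorem encard_nonPostcriticallyFiniteCycles_le :
    𝓕.nonPostcriticallyFiniteCycles.encard ≤ 𝓕.infiniteCriticalGrandOrbits.encard := by
  have hex : ∀ C : 𝓕.nonPostcriticallyFiniteCycles, ∃ c : Σ v, S v, c.1 ∈ C.1 ∧
      𝓕.IsCritical c ∧ (𝓕.orbit c).Infinite := fun C => C.2.2
  have hcyc : ∀ C, 𝓕.IsCycle C → ∀ v ∈ C, C = {v' | ∃ k, 𝓕.cover.F^[k] v = v'} := by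
    rintro _ ⟨v, -, ⟨p, hp, hper⟩, rfl⟩ _ ⟨m, rfl⟩
    have hpm : ∀ n, 𝓕.cover.F^[p * n] v = v := fun n => by
      rw [Function.iterate_mul]
      exact Function.iterate_fixed hper n
    ext v'
    constructor
    · rintro ⟨k, rfl⟩
      refine ⟨k + (p * m - m), ?_⟩
      have hle : m ≤ p * m := Nat.le_mul_of_pos_left m hp
      rw [← Function.iterate_add_apply, show k + (p * m - m) + m = k + p * m by omega,
        Function.iterate_add_apply, hpm]
    · rintro ⟨k, rfl⟩
      exact ⟨k + m, Function.iterate_add_apply _ _ _ _⟩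
  choose c hcC hc hinf using hex
  refine Function.Embedding.encard_le ⟨fun C => ⟨𝓕.grandOrbit (c C), ⟨c C, (hc C).1, rfl⟩, c C,
    𝓕.mem_grandOrbit_self (hc C).1, hc C, hinf C⟩, fun C C' heq => Subtype.ext ?_⟩
  have hmem : c C' ∈ 𝓕.grandOrbit (c C) := by
    rw [show 𝓕.grandOrbit (c C) = 𝓕.grandOrbit (c C') from congrArg Subtype.val heq]
    exact 𝓕.mem_grandOrbit_self (hc C').1
  obtain ⟨k, l, -, -, hkl⟩ := 𝓕.exists_iterate_eq hmem.2
  have h1 := congrArg Sigma.fst hkl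
  rw [step_iterate_fst, step_iterate_fst] at h1
  have h2 : 𝓕.cover.F^[k] (c C).1 ∈ C.1 := by
    have := hcyc C C.2.1 _ (hcC C)
    rw [this]
    exact ⟨k, rfl⟩
  have h3 : 𝓕.cover.F^[k] (c C).1 ∈ C'.1 := by
    have := hcyc C' C'.2.1 _ (hcC C')
    rw [this, h1]
    exact ⟨l, rfl⟩
  rw [hcyc C C.2.1 _ h2]
  exact (hcyc C' C'.2.1 _ h3).symm

end DynSystem

end SphereTrees

theorem theorem3p8 {V : Type*} {S : V → Type*} [∀ v, TopologicalSpace (S v)]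
    (𝓕 : SphereTrees.DynSystem V S) :
    ∃ D : ℕ, 𝓕.cover.HasDegree D ∧
      𝓕.infiniteCriticalGrandOrbits.encard + 2 ≤ 2 * (D : ℕ∞) ∧
      𝓕.nonPostcriticallyFiniteCycles.encard + 2 ≤ 2 * (D : ℕ∞) := by
  obtain ⟨w, hw⟩ : 𝓕.TZ.leaves.Nonempty :=
    Set.nonempty_of_ncard_ne_zero (by have := 𝓕.TZ.three_le_leaves; omega)
  have hbound : 𝓕.infiniteCriticalGrandOrbits.encard + 2 ≤
      2 * (𝓕.cover.fiberDegree w : ℕ∞) := by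
    have hfin : 𝓕.cover.criticalValueLeaves.Finite :=
      𝓕.TZ.finite_verts.subset fun y hy => (𝓕.cover.criticalValueLeaves_subset hy).1
    have h := 𝓕.encard_infiniteCriticalGrandOrbits_le
    rw [← hfin.cast_ncard_eq] at h
    refine (add_le_add_left h 2).trans ?_
    exact_mod_cast 𝓕.cover.ncard_criticalValueLeaves_add_two_le hw.1
  exact ⟨𝓕.cover.fiberDegree w, 𝓕.cover.hasDegree_fiberDegree hw.1, hbound,
    (add_le_add_left 𝓕.encard_nonPostcriticallyFiniteCycles_le 2).trans hbound⟩
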